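/- For a non-decreasing function $r:(0,\pi/2)\to[0,\infty)$ put $U_{\theta,r(\theta)}=\{z\in\mathbb C: |z|>r(\theta),\ |\arg z|<\theta\}$, $\Omega_r=\bigcup_{0<\theta<\pi/2}U_{\theta,r(\theta)}$ and $r(0)=\inf_{0<\theta<\pi/2} r(\theta)$. Let $S(r)$ be the space of holomorphic functions $\gamma:\Omega_r\to\mathbb C$ such that $p_{\theta,\eta}(\gamma)=\sup_{z\in U_{\theta,r(\theta)}}|\gamma(z)|e^{-\eta|z|}<\infty$ for all $\theta\in(0,\pi/2)$ and $\eta>0$, with the topology defined by the seminorms $p_{\theta,\eta}$. For $\alpha\in\mathbb C$ let $P_\alpha=-\partial_x^2+(\alpha x)^2$ on $L^2(-1,1)$ with domain $H^2(-1,1)\cap H^1_0(-1,1)$, and for real $\alpha$ let $\lambda_\alpha$ be its smallest eigenvalue. (a) There exist a non-decreasing $r_0:(0,\pi/2)\to[0,\infty)$ and $\gamma\in S(r_0)$ such that $\lambda_\alpha=\alpha+\gamma(\alpha)e^{-\alpha}$ for all real $\alpha>r_0(0)$. (b) Let $r_0,\gamma$ be any such pair. For $\alpha\in\Omega_{r_0}$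 define $\lambda_\alpha=\alpha+\gamma(\alpha)e^{-\alpha}$, and let $v_\alpha$ be the solution on $[-1,1]$ of $-v_\alpha''+(\alpha x)^2v_\alpha=\lambda_\alpha v_\alpha$, $v_\alpha(0)=1$, $v_\alpha'(0)=0$. Then $\alpha\mapsto v_\alpha(x)$ is holomorphic on $\Omega_{r_0}$ for every $x\in[-1,1]$, and for every $\alpha\in\Omega_{r_0}$ the function $v_\alpha$ is an eigenfunction of $P_\alpha$ with eigenvalue $\lambda_\alpha$ (in particular $v_\alpha(\pm1)=0$). Moreover, for every $0<\varepsilon\le1$ there is a non-decreasing function $r:(0,\pi/2)\to[0,\infty)$ with $r\ge r_0$ such that, writing ${}^{\varepsilon}w(x)(\alpha)=e^{\alpha(1-\varepsilon)x^2/2}v_\alpha(x)$ for $x\in[-1,1]$ and $\alpha\in\Omega_r$, every ${}^{\varepsilon}w(x)$ belongs to $S(r)$ and $\{{}^{\varepsilon}w(x): x\in[-1,1]\}$ is a bounded subset of $S(r)$. -/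

import Mathlib

open MeasureTheory
open scoped NNReal

noncomputable section

/-- Non-decreasing functions `r : (0, π/2) → ℝ₊`. -/
abbrev RadiusFn : Type := Set.Ioo (0 : ℝ) (Real.pi / 2) →o ℝ≥0

/-- The truncated sector `U_{θ,ρ} = {|z| > ρ, |arg z| < θ}`. -/
def truncSector (θ ρ : ℝ) : Set ℂ := {z | ρ < ‖z‖ ∧ |z.arg| < θ}

/-- The union over `θ ∈ (0, π/2)` of the truncated sectors `U_{θ,r(θ)}`. -/
def symbolDomain (r : RadiusFn) : Set ℂ :=
  ⋃ θ : Set.Ioo (0 : ℝ) (Real.pi / 2), truncSector θ (r θ)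

/-- `r(0) = inf_{0 < θ < π/2} r(θ)`. -/
def RadiusFn.atZero (r : RadiusFn) : ℝ≥0 := ⨅ θ, r θ

theorem truncSector_subset_symbolDomain (r : RadiusFn) (θ : Set.Ioo (0 : ℝ) (Real.pi / 2)) :
    truncSector θ (r θ) ⊆ symbolDomain r :=
  Set.subset_iUnion (fun θ : Set.Ioo (0 : ℝ) (Real.pi / 2) => truncSector θ (r θ)) θ

theorem symbolDomain_anti {r₀ r : RadiusFn} (h : r₀ ≤ r) : symbolDomain r ⊆ symbolDomain r₀ := by
  refine Set.iUnion_mono fun θ z hz => ⟨lt_of_le_of_lt ?_ hz.1, hz.2⟩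
  exact_mod_cast h θ

theorem ofReal_mem_symbolDomain {r : RadiusFn} {a : ℝ} (ha : (r.atZero : ℝ) < a) :
    (a : ℂ) ∈ symbolDomain r := by
  have h0 : 0 < a := lt_of_le_of_lt (NNReal.coe_nonneg _) ha
  have : Nonempty (Set.Ioo (0 : ℝ) (Real.pi / 2)) :=
    ⟨⟨Real.pi / 4, by constructor <;> linarith [Real.pi_pos]⟩⟩
  have ha' : r.atZero < a.toNNReal := by
    rw [← NNReal.coe_lt_coe, Real.coe_toNNReal _ h0.le]; exact ha
  obtain ⟨θ, hθ⟩ := exists_lt_of_ciInf_lt ha'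
  refine truncSector_subset_symbolDomain r θ ⟨?_, ?_⟩
  · rw [← NNReal.coe_lt_coe, Real.coe_toNNReal _ h0.le] at hθ
    rw [Complex.norm_real, Real.norm_of_nonneg h0.le]
    exact hθ
  · rw [Complex.arg_ofReal_of_nonneg h0.le, abs_zero]
    exact θ.2.1

/-- A function on a subset `Ω` of `ℂ` (open in all uses below) is holomorphic. -/
def IsHolomorphic {Ω : Set ℂ} (f : Ω → ℂ) : Prop :=
  ∃ F : ℂ → ℂ, DifferentiableOn ℂ F Ω ∧ ∀ z : Ω, f z = F z

/-- The quantity `|γ(z)| e^{-ε|z|}` for `z ∈ U_{θ,r(θ)}`. -/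
def weightedNorm (r : RadiusFn) (θ : Set.Ioo (0 : ℝ) (Real.pi / 2)) (ε : ℝ)
    (γ : symbolDomain r → ℂ) (z : truncSector θ (r θ)) : ℝ :=
  ‖γ (Set.inclusion (truncSector_subset_symbolDomain r θ) z)‖ * Real.exp (-ε * ‖(z : ℂ)‖)

theorem weightedNorm_nonneg (r : RadiusFn) (θ : Set.Ioo (0 : ℝ) (Real.pi / 2)) (ε : ℝ)
    (γ : symbolDomain r → ℂ) (z : truncSector θ (r θ)) : 0 ≤ weightedNorm r θ ε γ z :=
  mul_nonneg (norm_nonneg _) (Real.exp_pos _).le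

theorem weightedNorm_add_le (r : RadiusFn) (θ : Set.Ioo (0 : ℝ) (Real.pi / 2)) (ε : ℝ)
    (γ η : symbolDomain r → ℂ) (z : truncSector θ (r θ)) :
    weightedNorm r θ ε (γ + η) z ≤ weightedNorm r θ ε γ z + weightedNorm r θ ε η z := by
  unfold weightedNorm
  rw [← add_mul]
  exact mul_le_mul_of_nonneg_right (norm_add_le _ _) (Real.exp_pos _).le

theorem weightedNorm_smul (r : RadiusFn) (θ : Set.Ioo (0 : ℝ) (Real.pi / 2)) (ε : ℝ)
    (c : ℂ) (γ : symbolDomain r → ℂ) (z : truncSector θ (r θ)) :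
    weightedNorm r θ ε (c • γ) z = ‖c‖ * weightedNorm r θ ε γ z := by
  unfold weightedNorm
  rw [Pi.smul_apply, norm_smul, mul_assoc]

/-- The vector space underlying `S(r)`: holomorphic functions on the union of the
`U_{θ,r(θ)}` with sub-exponential growth on each `U_{θ,r(θ)}`. -/
def symbolSubmodule (r : RadiusFn) : Submodule ℂ (symbolDomain r → ℂ) where
  carrier := {γ | IsHolomorphic γ ∧
    ∀ θ (ε : ℝ), 0 < ε → BddAbove (Set.range (weightedNorm r θ ε γ))}
  zero_mem' := by
    refine ⟨⟨0, differentiableOn_const 0, fun _ => rfl⟩, fun θ ε _ => ⟨0, ?_⟩⟩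
    rintro _ ⟨z, rfl⟩
    simp [weightedNorm]
  add_mem' := by
    rintro γ η ⟨⟨F, hF, hγ⟩, hb⟩ ⟨⟨G, hG, hη⟩, hc⟩
    refine ⟨⟨F + G, hF.add hG, fun z => by simp [hγ, hη]⟩, fun θ ε hε => ?_⟩
    obtain ⟨B, hB⟩ := hb θ ε hε
    obtain ⟨C, hC⟩ := hc θ ε hε
    refine ⟨B + C, ?_⟩
    rintro _ ⟨z, rfl⟩
    exact (weightedNorm_add_le r θ ε γ η z).trans (add_le_add (hB ⟨z, rfl⟩) (hC ⟨z, rfl⟩))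
  smul_mem' := by
    rintro c γ ⟨⟨F, hF, hγ⟩, hb⟩
    refine ⟨⟨c • F, hF.const_smul c, fun z => by simp [hγ]⟩, fun θ ε hε => ?_⟩
    obtain ⟨B, hB⟩ := hb θ ε hε
    refine ⟨‖c‖ * B, ?_⟩
    rintro _ ⟨z, rfl⟩
    rw [weightedNorm_smul]
    exact mul_le_mul_of_nonneg_left (hB ⟨z, rfl⟩) (norm_nonneg c)

/-- The symbol space `S(r)`. A type of its own, so that its topology is the one defined by the
seminorms `p_{θ,ε}` and not the topology of pointwise convergence. -/
def SymbolSpace (r : RadiusFn) : Type := symbolSubmodule r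

instance (r : RadiusFn) : AddCommGroup (SymbolSpace r) :=
  inferInstanceAs (AddCommGroup (symbolSubmodule r))

instance (r : RadiusFn) : Module ℂ (SymbolSpace r) :=
  inferInstanceAs (Module ℂ (symbolSubmodule r))

/-- The function on the union of the `U_{θ,r(θ)}` given by an element of `S(r)`. -/
def SymbolSpace.toFun {r : RadiusFn} (γ : SymbolSpace r) : symbolDomain r → ℂ := γ.1

instance (r : RadiusFn) : CoeFun (SymbolSpace r) (fun _ => symbolDomain r → ℂ) :=
  ⟨SymbolSpace.toFun⟩

/-- The seminorm `p_{θ,ε}(γ) = sup_{z ∈ U_{θ,r(θ)}} |γ(z) e^{-ε|z|}|` on `S(r)`, `ε > 0`. -/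
def symbolSeminorm (r : RadiusFn) (θ : Set.Ioo (0 : ℝ) (Real.pi / 2)) (ε : Set.Ioi (0 : ℝ)) :
    Seminorm ℂ (SymbolSpace r) :=
  Seminorm.of (fun γ => ⨆ z, weightedNorm r θ ε γ z)
    (fun γ η => by
      refine Real.iSup_le (fun z => ?_) (add_nonneg
        (Real.iSup_nonneg (weightedNorm_nonneg r θ ε γ))
        (Real.iSup_nonneg (weightedNorm_nonneg r θ ε η)))
      exact (weightedNorm_add_le r θ ε γ η z).trans
        (add_le_add (le_ciSup (γ.2.2 θ ε ε.2) z) (le_ciSup (η.2.2 θ ε ε.2) z)))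
    (fun c γ => by
      rw [Real.mul_iSup_of_nonneg (norm_nonneg c)]
      exact iSup_congr fun z => weightedNorm_smul r θ ε c γ z)

/-- The family of all seminorms `p_{θ,ε}`, `θ ∈ (0, π/2)`, `ε > 0`. -/
def symbolSeminormFamily (r : RadiusFn) :
    SeminormFamily ℂ (SymbolSpace r) (Set.Ioo (0 : ℝ) (Real.pi / 2) × Set.Ioi (0 : ℝ)) :=
  fun i => symbolSeminorm r i.1 i.2

/-- The locally convex topology of `S(r)`, defined by the seminorms `p_{θ,ε}`. -/
instance (r : RadiusFn) : TopologicalSpace (SymbolSpace r) :=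
  (symbolSeminormFamily r).moduleFilterBasis.topology

/-- `u ∈ H²(-1,1) ∩ H¹₀(-1,1)` with first and second derivatives `u₁`, `u₂`: in one dimension
this says that (the continuous representative) `u` vanishes at `±1`, that `u` is a primitive of
`u₁`, and that `u₁` is a primitive of the function `u₂ ∈ L²(-1,1)`. -/
structure InDirichletDomain (u u₁ u₂ : ℝ → ℂ) : Prop where
  memLp : MemLp u₂ 2 (volume.restrict (Set.Ioo (-1 : ℝ) 1))
  deriv_eq : ∀ x ∈ Set.Icc (-1 : ℝ) 1, u₁ x = u₁ (-1) + ∫ t in (-1 : ℝ)..x, u₂ t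
  eq : ∀ x ∈ Set.Icc (-1 : ℝ) 1, u x = ∫ t in (-1 : ℝ)..x, u₁ t
  right : u 1 = 0

/-- `u` is an eigenfunction, with eigenvalue `μ`, of the operator `P_α = -∂ₓ² + (αx)²` on
`L²(-1,1)` with domain `H²(-1,1) ∩ H¹₀(-1,1)`. -/
def IsDirichletEigenfunction (α μ : ℂ) (u : ℝ → ℂ) : Prop :=
  (∃ x ∈ Set.Icc (-1 : ℝ) 1, u x ≠ 0) ∧
  ∃ u₁ u₂ : ℝ → ℂ, InDirichletDomain u u₁ u₂ ∧
    ∀ᵐ x ∂(volume.restrict (Set.Ioo (-1 : ℝ) 1)), -u₂ x + (α * x) ^ 2 * u x = μ * u x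

/-- `μ = λ_a` is the first eigenvalue of `P_a`, for real `a` (where all eigenvalues are real). -/
def IsFirstEigenvalue (a μ : ℝ) : Prop :=
  IsLeast {ν : ℝ | ∃ u : ℝ → ℂ, IsDirichletEigenfunction a ν u} μ

/-- `u` solves `-u'' + (αx)² u = μ u` on `[-1,1]` (in the classical sense), with `u(0) = 1` and
`u'(0) = 0`. -/
def IsNormalizedSolution (α μ : ℂ) (u : ℝ → ℂ) : Prop :=
  ∃ u₁ u₂ : ℝ → ℂ, u 0 = 1 ∧ u₁ 0 = 0 ∧
    ∀ x ∈ Set.Icc (-1 : ℝ) 1,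
      HasDerivWithinAt u (u₁ x) (Set.Icc (-1) 1) x ∧
      HasDerivWithinAt u₁ (u₂ x) (Set.Icc (-1) 1) x ∧
      -u₂ x + (α * x) ^ 2 * u x = μ * u x

/-- The extended eigenvalue `λ_α = α + γ(α) e^{-α}`. -/
def extendedEigenvalue {r : RadiusFn} (γ : SymbolSpace r) (α : symbolDomain r) : ℂ :=
  α + γ α * Complex.exp (-α)

/-- `λ_α = α + γ(α) e^{-α}`, with `γ ∈ S(r)`, extends the first eigenvalue from the reals
`α > r(0)` to the union of the `U_{θ,r(θ)}`, and `v_α` is the corresponding solution of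
`-v'' + (αx)² v = λ_α v`, `v(0) = 1`, `v'(0) = 0`. -/
structure IsEigenpairExtension (r : RadiusFn) (γ : SymbolSpace r)
    (v : symbolDomain r → ℝ → ℂ) : Prop where
  eigenvalue : ∀ (a : ℝ) (ha : (r.atZero : ℝ) < a), ∃ μ : ℝ, IsFirstEigenvalue a μ ∧
    (μ : ℂ) = extendedEigenvalue γ ⟨a, ofReal_mem_symbolDomain ha⟩
  solution : ∀ α : symbolDomain r, IsNormalizedSolution α (extendedEigenvalue γ α) (v α)

end

/-!
The even solution of `-v'' + (αx)² v = (α + μ) v` with `v(0) = 1` is `e^{-αx²/2} (1 - μ g(x))`, where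
`g` solves `g'' - 2αx g' + μ g = 1` with `g(0) = g'(0) = 0`. Here `g(x) = k(x²)` is `evenCorrector`,
and `k` is an entire function given by an explicit power series, `corrector`, so that everything
depends holomorphically on `α` and `μ`. The Dirichlet condition at `±1` becomes `μ g(1) = 1`.

Everything rests on two estimates for `g`, with `b = Re α > 0`. For `|μ| ≤ b` one has
`|g(x)| ≤ e^{bx²}/b` (`norm_evenCorrector_le`): integrate `(e^{-αx²} g')' = e^{-αx²} (1 - μ g)` twice.
Conversely `|g(1)|` is at least a constant times `e^b |α|^{-3/2}` in sectors, for large `α`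
(`norm_evenCorrector_zero_one_ge`, `norm_evenCorrector_one_ge`): for `μ = 0` this reduces to the
Gaussian integral `∫₀¹ e^{-αs²} ds`, and Cauchy's estimate controls the dependence on `μ`.

Hence `μ ↦ 1 / g(1)` is a contraction of a small disc, its fixed point `μ(α)` is holomorphic as a
uniform limit of iterates, and `|μ(α)| ≤ 5 |α|^{3/2} e^{-b}` (`exists_holomorphic_root`). So
`γ(α) = μ(α) e^α` is a symbol. For real `α`, a Riccati argument (`eqOn_zero_of_riccati`) shows that
no eigenvalue lies below `α`, and that an eigenvalue below `α + 1/4` has an eigenfunction with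
`u(0) ≠ 0`, whose even part is the even solution; so `α + μ(α)` is the first eigenvalue.

Given an arbitrary pair `(r, γ)`, the equation `μ g(1) = 1` holds for `μ = γ(α) e^{-α}` at large real
`α`, hence on the whole connected domain by the identity theorem (`IsEigenpairExtension.root`).
Finally `|e^{α(1-ε)x²/2} v_α(x)| ≤ |1 - μ g(x)|`, and the first estimate bounds the right-hand side
by `1 + |γ(α)|` when `b ≥ 1` and `|μ| ≤ b`; in a sector the remaining `α` either have `b < 1` and
`|μ| ≤ b`, where the estimate is a constant, or form a bounded set. So the family is bounded in
`S(r)` for the given `r`.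
-/

/-! ### Entire functions given by their coefficients -/

section EntireSeries

variable {c : ℕ → ℂ} {C K : ℝ}

theorem summable_pow_div_factorial_mul (C x : ℝ) :
    Summable fun n : ℕ => C * (x ^ n / (n.factorial : ℝ)) :=
  (Real.summable_pow_div_factorial x).mul_left C

theorem norm_coeff_mul_pow_le (hc : ∀ n, ‖c n‖ ≤ C * (K ^ n / (n.factorial : ℝ))) (z : ℂ) (n : ℕ) :
    ‖c n * z ^ n‖ ≤ C * ((K * ‖z‖) ^ n / (n.factorial : ℝ)) := by
  rw [norm_mul, norm_pow]
  calc ‖c n‖ * ‖z‖ ^ n ≤ C * (K ^ n / (n.factorial : ℝ)) * ‖z‖ ^ n :=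
        mul_le_mul_of_nonneg_right (hc n) (by positivity)
    _ = C * ((K * ‖z‖) ^ n / (n.factorial : ℝ)) := by rw [mul_pow]; ring

theorem summable_coeff_mul_pow (hc : ∀ n, ‖c n‖ ≤ C * (K ^ n / (n.factorial : ℝ))) (z : ℂ) :
    Summable fun n => c n * z ^ n :=
  Summable.of_norm_bounded (summable_pow_div_factorial_mul C (K * ‖z‖))
    (norm_coeff_mul_pow_le hc z)

theorem norm_tsum_coeff_mul_pow_le (hc : ∀ n, ‖c n‖ ≤ C * (K ^ n / (n.factorial : ℝ))) (z : ℂ) :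
    ‖∑' n, c n * z ^ n‖ ≤ C * Real.exp (K * ‖z‖) := by
  refine tsum_of_norm_bounded ?_ (norm_coeff_mul_pow_le hc z)
  refine HasSum.mul_left C ?_
  rw [Real.exp_eq_exp_ℝ]
  exact NormedSpace.expSeries_div_hasSum_exp (K * ‖z‖)

theorem norm_succ_mul_coeff_le (hc : ∀ n, ‖c n‖ ≤ C * (K ^ n / (n.factorial : ℝ))) (n : ℕ) :
    ‖((n : ℂ) + 1) * c (n + 1)‖ ≤ C * K * (K ^ n / (n.factorial : ℝ)) := by
  have h1 : ‖((n : ℂ) + 1)‖ = (n : ℝ) + 1 := by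
    rw [← Nat.cast_succ, Complex.norm_natCast, Nat.cast_succ]
  rw [norm_mul, h1]
  calc ((n : ℝ) + 1) * ‖c (n + 1)‖
      ≤ ((n : ℝ) + 1) * (C * (K ^ (n + 1) / ((n + 1).factorial : ℝ))) :=
        mul_le_mul_of_nonneg_left (hc _) (by positivity)
    _ = C * K * (K ^ n / (n.factorial : ℝ)) := by
        rw [Nat.factorial_succ]; push_cast; field_simp; ring

/-- Termwise differentiation of an entire function of exponential type. The derived coefficients
satisfy a bound of the same form, so that the lemma can be iterated. -/
theorem hasDerivAt_tsum_coeff_mul_pow (hc : ∀ n, ‖c n‖ ≤ C * (K ^ n / (n.factorial : ℝ))) (z : ℂ) :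
    HasDerivAt (fun z => ∑' n, c n * z ^ n) (∑' n : ℕ, ((n : ℂ) + 1) * c (n + 1) * z ^ n) z := by
  have hC : 0 ≤ C := by simpa using (norm_nonneg _).trans (hc 0)
  set R : ℝ := ‖z‖ + 1
  have hb : ∀ (n : ℕ) (y : ℂ), y ∈ Metric.ball (0 : ℂ) R →
      ‖c n * (n * y ^ (n - 1))‖ ≤ ‖c n‖ * (n * R ^ (n - 1)) := by
    intro n y hy
    rw [mem_ball_zero_iff] at hy
    rw [norm_mul, norm_mul, norm_pow, Complex.norm_natCast]
    gcongr
  have hsum : Summable fun n : ℕ => ‖c n‖ * (n * R ^ (n - 1)) := by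
    rw [← summable_nat_add_iff 1]
    have h0 : 0 ≤ R := by positivity
    refine (summable_coeff_mul_pow (norm_succ_mul_coeff_le hc) (R : ℂ)).norm.congr fun n => ?_
    have h1 : ‖((n : ℂ) + 1)‖ = (n : ℝ) + 1 := by
      rw [← Nat.cast_succ, Complex.norm_natCast, Nat.cast_succ]
    rw [norm_mul, norm_mul, h1, norm_pow, Complex.norm_real, Real.norm_of_nonneg h0]
    push_cast [add_tsub_cancel_right]
    ring
  have hz : z ∈ Metric.ball (0 : ℂ) R := by
    rw [mem_ball_zero_iff]; exact lt_add_one _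
  have h := hasDerivAt_tsum_of_isPreconnected (g := fun n y => c n * y ^ n)
    (g' := fun n y => c n * (n * y ^ (n - 1))) hsum Metric.isOpen_ball
    (convex_ball (0 : ℂ) R).isPreconnected
    (fun n y _ => (hasDerivAt_pow n y).const_mul (c n)) hb hz (summable_coeff_mul_pow hc z) hz
  refine h.congr_deriv ?_
  have hs : Summable fun n : ℕ => c n * (n * z ^ (n - 1)) :=
    Summable.of_norm_bounded hsum fun n => hb n z hz
  rw [hs.tsum_eq_zero_add]
  simp only [Nat.cast_zero, zero_mul, mul_zero, zero_add, Nat.cast_add, Nat.cast_one,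
    add_tsub_cancel_right]
  exact tsum_congr fun n => by ring

end EntireSeries

/-! ### The even solution as a power series -/

/-- The Taylor coefficients of `corrector α μ`, by the recursion that the differential equation
`hasDerivAt_evenCorrectorDeriv` forces. -/
noncomputable def correctorCoeff (α μ : ℂ) : ℕ → ℂ
  | 0 => 0
  | n + 1 => ((4 * n * α - μ) * correctorCoeff α μ n + if n = 0 then 1 else 0) /
      ((2 * n + 1) * (2 * n + 2))

theorem correctorCoeff_succ (α μ : ℂ) (n : ℕ) :
    correctorCoeff α μ (n + 1) = ((4 * n * α - μ) * correctorCoeff α μ n +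
      if n = 0 then 1 else 0) / ((2 * n + 1) * (2 * n + 2)) := rfl

/-- The exponential type `2|α| + |μ| + 1` that bounds the growth of `corrector α μ`. -/
noncomputable def correctorType (α μ : ℂ) : ℝ := 2 * ‖α‖ + ‖μ‖ + 1

theorem norm_correctorCoeff_le {α μ : ℂ} {K : ℝ} (hK : correctorType α μ ≤ K) (n : ℕ) :
    ‖correctorCoeff α μ n‖ ≤ 1 * (K ^ n / (n.factorial : ℝ)) := by
  have hα := norm_nonneg α
  have hμ := norm_nonneg μ
  unfold correctorType at hK
  have hK1 : 1 ≤ K := by linarith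
  rw [one_mul]
  induction n with
  | zero => simp [correctorCoeff]
  | succ n ih =>
    rcases Nat.eq_zero_or_pos n with rfl | hn
    · simp [correctorCoeff]; linarith
    · have h1 : ‖((2 * (n : ℂ) + 1) * (2 * n + 2))‖ = (2 * (n : ℝ) + 1) * (2 * n + 2) := by
        have : ((2 * (n : ℂ) + 1) * (2 * n + 2)) = (((2 * (n : ℝ) + 1) * (2 * n + 2) : ℝ) : ℂ) := by
          push_cast; ring
        rw [this, Complex.norm_real, Real.norm_of_nonneg (by positivity)]
      have h2 : ‖4 * (n : ℂ) * α - μ‖ ≤ (2 * n + 1) * K := by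
        refine (norm_sub_le _ _).trans ?_
        rw [norm_mul, norm_mul, Complex.norm_natCast]
        norm_num
        have hn' : (1 : ℝ) ≤ n := by exact_mod_cast hn
        nlinarith [mul_le_mul_of_nonneg_left hK (show (0 : ℝ) ≤ 2 * n + 1 by positivity),
          mul_nonneg (Nat.cast_nonneg n : (0 : ℝ) ≤ n) hμ]
      rw [correctorCoeff_succ, if_neg hn.ne', add_zero, norm_div, h1, norm_mul, Nat.factorial_succ,
        div_le_div_iff₀ (by positivity) (by positivity)]
      have hf : (0 : ℝ) < n.factorial := by positivity
      rw [le_div_iff₀ hf] at ih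
      push_cast
      calc ‖4 * (n : ℂ) * α - μ‖ * ‖correctorCoeff α μ n‖ * (((n : ℝ) + 1) * n.factorial)
          = ‖4 * (n : ℂ) * α - μ‖ * (‖correctorCoeff α μ n‖ * n.factorial) * ((n : ℝ) + 1) := by
            ring
        _ ≤ ((2 * n + 1) * K) * K ^ n * ((n : ℝ) + 1) := by gcongr
        _ ≤ K ^ (n + 1) * ((2 * (n : ℝ) + 1) * (2 * n + 2)) := by
            have : 0 ≤ K ^ (n + 1) * ((2 * (n : ℝ) + 1) * (n + 1)) := by positivity
            rw [pow_succ] at *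
            nlinarith

/-- The entire function `k` such that `e^{-αx²/2} (1 - μ k(x²))` is the even solution of
`-v'' + (αx)² v = (α + μ) v` with `v(0) = 1`. (In terms of Kummer's function,
`1 - μ k(z) = M(-μ/4α, 1/2, αz)`.) -/
noncomputable def corrector (α μ z : ℂ) : ℂ := ∑' n, correctorCoeff α μ n * z ^ n

theorem norm_corrector_le {α μ z : ℂ} {K : ℝ} (hK : correctorType α μ ≤ K) (hz : ‖z‖ ≤ 1) :
    ‖corrector α μ z‖ ≤ Real.exp K := by
  have hK0 : 0 ≤ K := le_trans (by unfold correctorType; positivity) hK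
  refine (norm_tsum_coeff_mul_pow_le (norm_correctorCoeff_le hK) z).trans ?_
  rw [one_mul]
  exact Real.exp_le_exp.2 (mul_le_of_le_one_right hK0 hz)

theorem corrector_zero (α μ : ℂ) : corrector α μ 0 = 0 := by
  unfold corrector
  rw [tsum_eq_single 0]
  · simp [correctorCoeff]
  · intro n hn; simp [hn]

theorem corrector_conj (α μ z : ℂ) : corrector ((starRingEnd ℂ) α) ((starRingEnd ℂ) μ)
    ((starRingEnd ℂ) z) = (starRingEnd ℂ) (corrector α μ z) := by
  unfold corrector
  rw [Complex.conj_tsum]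
  refine tsum_congr fun n => ?_
  rw [map_mul, map_pow]
  congr 1
  induction n with
  | zero => simp [correctorCoeff]
  | succ n ih =>
    rw [correctorCoeff_succ, correctorCoeff_succ, ih]
    simp only [map_div₀, map_mul, map_add, map_sub, map_natCast, map_ofNat, map_one]
    split_ifs <;> simp

theorem differentiableAt_correctorCoeff {f g : ℂ → ℂ} {a : ℂ} (hf : DifferentiableAt ℂ f a)
    (hg : DifferentiableAt ℂ g a) (n : ℕ) :
    DifferentiableAt ℂ (fun w => correctorCoeff (f w) (g w) n) a := by
  induction n with
  | zero => simp [correctorCoeff]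
  | succ n ih =>
    simp only [correctorCoeff_succ]
    exact ((((hf.const_mul _).sub hg).mul ih).add_const _).div_const _

/-- The corrector depends holomorphically on its parameters. -/
theorem differentiableOn_corrector {f g : ℂ → ℂ} {U : Set ℂ} (hU : IsOpen U)
    (hf : DifferentiableOn ℂ f U) (hg : DifferentiableOn ℂ g U) (z : ℂ) :
    DifferentiableOn ℂ (fun w => corrector (f w) (g w) z) U := by
  intro a ha
  have hc : ContinuousAt (fun w => correctorType (f w) (g w)) a := by
    have h1 := (hf.differentiableAt (hU.mem_nhds ha)).continuousAt
    have h2 := (hg.differentiableAt (hU.mem_nhds ha)).continuousAt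
    unfold correctorType
    fun_prop
  obtain ⟨V, hV, hVo, haV⟩ := mem_nhds_iff.1 (Filter.inter_mem (hU.mem_nhds ha)
    (hc.eventually (gt_mem_nhds (lt_add_one (correctorType (f a) (g a))))))
  set K := correctorType (f a) (g a) + 1
  have h := Complex.differentiableOn_tsum_of_summable_norm (U := V)
    (F := fun n w => correctorCoeff (f w) (g w) n * z ^ n)
    (summable_pow_div_factorial_mul 1 (K * ‖z‖))
    (fun n w hw => ((differentiableAt_correctorCoeff
      (hf.differentiableAt (hU.mem_nhds (hV hw).1))
      (hg.differentiableAt (hU.mem_nhds (hV hw).1)) n).mul_const _).differentiableWithinAt) hVo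
    (fun n w hw => norm_coeff_mul_pow_le (norm_correctorCoeff_le (le_of_lt (hV hw).2)) z n)
  exact (h.differentiableAt (hVo.mem_nhds haV)).differentiableWithinAt

/-- The function `x ↦ k(x²)`, where `k` is the corrector. -/
noncomputable def evenCorrector (α μ : ℂ) (x : ℝ) : ℂ := corrector α μ ((x : ℂ) ^ 2)

/-- The derivative of `evenCorrector`. -/
noncomputable def evenCorrectorDeriv (α μ : ℂ) (x : ℝ) : ℂ :=
  2 * x * ∑' n : ℕ, ((n : ℂ) + 1) * correctorCoeff α μ (n + 1) * ((x : ℂ) ^ 2) ^ n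

theorem evenCorrector_zero (α μ : ℂ) : evenCorrector α μ 0 = 0 := by
  simp [evenCorrector, corrector_zero]

theorem evenCorrectorDeriv_zero (α μ : ℂ) : evenCorrectorDeriv α μ 0 = 0 := by
  simp [evenCorrectorDeriv]

theorem evenCorrector_neg (α μ : ℂ) (x : ℝ) : evenCorrector α μ (-x) = evenCorrector α μ x := by
  simp [evenCorrector]

theorem hasDerivAt_evenCorrector (α μ : ℂ) (x : ℝ) :
    HasDerivAt (evenCorrector α μ) (evenCorrectorDeriv α μ x) x := by
  have h := (hasDerivAt_tsum_coeff_mul_pow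
    (norm_correctorCoeff_le (le_refl (correctorType α μ))) ((x : ℂ) ^ 2)).comp (x : ℂ)
    (hasDerivAt_pow 2 (x : ℂ))
  refine h.comp_ofReal.congr_deriv ?_
  unfold evenCorrectorDeriv
  push_cast
  ring

/-- The equation `g'' - 2αx g' + μ g = 1`. -/
theorem hasDerivAt_evenCorrectorDeriv (α μ : ℂ) (x : ℝ) :
    HasDerivAt (evenCorrectorDeriv α μ)
      (1 + 2 * α * x * evenCorrectorDeriv α μ x - μ * evenCorrector α μ x) x := by
  have hc := norm_correctorCoeff_le (le_refl (correctorType α μ))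
  have hc1 := norm_succ_mul_coeff_le hc
  have hc2 := norm_succ_mul_coeff_le hc1
  set z : ℂ := (x : ℂ) ^ 2 with hz
  have h := ((hasDerivAt_id (x : ℂ)).const_mul (2 : ℂ)).mul
    ((hasDerivAt_tsum_coeff_mul_pow hc1 ((x : ℂ) ^ 2)).comp (x : ℂ) (hasDerivAt_pow 2 (x : ℂ)))
  refine (h.comp_ofReal).congr_deriv ?_
  have s0 := (summable_coeff_mul_pow hc z).hasSum
  have s1 := (summable_coeff_mul_pow hc1 z).hasSum
  have s2 := (summable_coeff_mul_pow hc2 z).hasSum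
  -- Multiplication by `z` shifts the coefficients.
  have t1 : HasSum (fun n : ℕ => (n : ℂ) * correctorCoeff α μ n * z ^ n)
      (z * ∑' n : ℕ, ((n : ℂ) + 1) * correctorCoeff α μ (n + 1) * z ^ n) := by
    rw [← hasSum_nat_add_iff' 1]
    simp only [Finset.range_one, Finset.sum_singleton, Nat.cast_zero, zero_mul, sub_zero]
    refine Eq.mpr (congrArg (fun f => HasSum f _) (funext fun n => ?_)) (s1.mul_left z)
    push_cast
    ring
  have t2 : HasSum (fun n : ℕ => (n : ℂ) * (((n : ℂ) + 1) * correctorCoeff α μ (n + 1)) * z ^ n)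
      (z * ∑' n : ℕ, ((n : ℂ) + 1) * ((((n + 1 : ℕ) : ℂ) + 1) * correctorCoeff α μ (n + 1 + 1)) *
        z ^ n) := by
    rw [← hasSum_nat_add_iff' 1]
    simp only [Finset.range_one, Finset.sum_singleton, Nat.cast_zero, zero_mul, sub_zero]
    refine Eq.mpr (congrArg (fun f => HasSum f _) (funext fun n => ?_)) (s2.mul_left z)
    push_cast
    ring
  have t3 : HasSum (fun n : ℕ => (if n = 0 then (1 : ℂ) else 0) * z ^ n) 1 := by
    convert hasSum_ite_eq (0 : ℕ) (1 : ℂ) using 2 with n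
    split_ifs with h0 <;> simp [h0]
  have key := ((t2.mul_left 4).add (s1.mul_left 2)).sub
    (((t1.mul_left (4 * α)).sub (s0.mul_left μ)).add t3)
  have hzero : ∀ n : ℕ, 4 * ((n : ℂ) * (((n : ℂ) + 1) * correctorCoeff α μ (n + 1)) * z ^ n) +
      2 * (((n : ℂ) + 1) * correctorCoeff α μ (n + 1) * z ^ n) -
      (4 * α * ((n : ℂ) * correctorCoeff α μ n * z ^ n) - μ * (correctorCoeff α μ n * z ^ n) +
        (if n = 0 then (1 : ℂ) else 0) * z ^ n) = 0 := by
    intro n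
    have h1 : (2 * (n : ℂ) + 1) ≠ 0 := by exact_mod_cast (2 * n).succ_ne_zero
    have h2 : (2 * (n : ℂ) + 2) ≠ 0 := by exact_mod_cast (2 * n + 1).succ_ne_zero
    have h3 : correctorCoeff α μ (n + 1) * ((2 * n + 1) * (2 * n + 2)) =
        (4 * n * α - μ) * correctorCoeff α μ n + if n = 0 then 1 else 0 := by
      rw [correctorCoeff_succ, div_mul_cancel₀ _ (mul_ne_zero h1 h2)]
    linear_combination z ^ n * h3
  simp only [hzero] at key
  have key' := key.unique hasSum_zero
  have e0 : evenCorrector α μ x = ∑' n, correctorCoeff α μ n * z ^ n := rfl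
  have e1 : evenCorrectorDeriv α μ x =
    2 * x * ∑' n : ℕ, ((n : ℂ) + 1) * correctorCoeff α μ (n + 1) * z ^ n := rfl
  rw [e0, e1]
  simp only [Function.comp, id, mul_one, ← hz]
  push_cast at key' ⊢
  simp only [hz] at key' ⊢
  linear_combination key'

/-- The even solution `e^{-αx²/2} (1 - μ k(x²))` of `-v'' + (αx)² v = (α + μ) v`. -/
noncomputable def evenSolution (α μ : ℂ) (x : ℝ) : ℂ :=
  Complex.exp (-α * (x : ℂ) ^ 2 / 2) * (1 - μ * evenCorrector α μ x)

theorem evenSolution_neg (α μ : ℂ) (x : ℝ) : evenSolution α μ (-x) = evenSolution α μ x := by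
  simp [evenSolution, evenCorrector_neg]

theorem evenSolution_one_eq_zero_iff {α μ : ℂ} :
    evenSolution α μ 1 = 0 ↔ μ * evenCorrector α μ 1 = 1 := by
  simp only [evenSolution, mul_eq_zero, Complex.exp_ne_zero, false_or, sub_eq_zero]
  exact eq_comm

theorem isNormalizedSolution_evenSolution (α μ : ℂ) :
    IsNormalizedSolution α (α + μ) (evenSolution α μ) := by
  have he : ∀ x : ℝ, HasDerivAt (fun x : ℝ => Complex.exp (-α * (x : ℂ) ^ 2 / 2))
      (-α * x * Complex.exp (-α * (x : ℂ) ^ 2 / 2)) x := by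
    intro x
    have h := ((((hasDerivAt_pow 2 (x : ℂ)).const_mul (-α)).div_const 2).cexp).comp_ofReal
    refine h.congr_deriv ?_
    push_cast
    ring
  have hm : ∀ x : ℝ, HasDerivAt (fun x : ℝ => 1 - μ * evenCorrector α μ x)
      (-(μ * evenCorrectorDeriv α μ x)) x := fun x =>
    ((hasDerivAt_evenCorrector α μ x).const_mul μ).const_sub 1
  have hm' := fun x : ℝ => ((hasDerivAt_evenCorrectorDeriv α μ x).const_mul μ).neg
  have hx : ∀ x : ℝ, HasDerivAt (fun x : ℝ => -α * (x : ℂ)) (-α) x := by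
    intro x
    simpa using ((hasDerivAt_id (x : ℂ)).const_mul (-α)).comp_ofReal
  refine ⟨fun x => -α * x * Complex.exp (-α * (x : ℂ) ^ 2 / 2) * (1 - μ * evenCorrector α μ x) +
    Complex.exp (-α * (x : ℂ) ^ 2 / 2) * (-(μ * evenCorrectorDeriv α μ x)),
    fun x => ((α * x) ^ 2 - (α + μ)) * evenSolution α μ x, ?_, ?_, fun x _ => ⟨?_, ?_, ?_⟩⟩
  · simp [evenSolution, evenCorrector_zero]
  · simp [evenCorrectorDeriv_zero]
  · exact ((he x).mul (hm x)).hasDerivWithinAt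
  · have h := (((hx x).mul (he x)).mul (hm x)).add ((he x).mul (hm' x))
    refine (h.congr_deriv ?_).hasDerivWithinAt
    simp only [evenSolution, Pi.mul_apply, Pi.neg_apply]
    ring
  · ring

/-- Uniqueness in the initial value problem for `-v'' + (αx)² v = ν v` on `[-1, 1]`. -/
theorem IsNormalizedSolution.eqOn {α ν : ℂ} {u v : ℝ → ℂ} (hu : IsNormalizedSolution α ν u)
    (hv : IsNormalizedSolution α ν v) : Set.EqOn u v (Set.Icc (-1) 1) := by
  obtain ⟨u₁, u₂, hu0, hu10, hu⟩ := hu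
  obtain ⟨v₁, v₂, hv0, hv10, hv⟩ := hv
  have cont : ∀ {w w₁ w₂ : ℝ → ℂ}, (∀ x ∈ Set.Icc (-1 : ℝ) 1,
      HasDerivWithinAt w (w₁ x) (Set.Icc (-1) 1) x ∧
      HasDerivWithinAt w₁ (w₂ x) (Set.Icc (-1) 1) x ∧ -w₂ x + (α * x) ^ 2 * w x = ν * w x) →
      ContinuousOn (fun x => (w x, w₁ x)) (Set.Icc (-1) 1) := fun h x hx =>
    ((h x hx).1.continuousWithinAt).prodMk (h x hx).2.1.continuousWithinAt
  have der : ∀ {w w₁ w₂ : ℝ → ℂ}, (∀ x ∈ Set.Icc (-1 : ℝ) 1,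
      HasDerivWithinAt w (w₁ x) (Set.Icc (-1) 1) x ∧
      HasDerivWithinAt w₁ (w₂ x) (Set.Icc (-1) 1) x ∧ -w₂ x + (α * x) ^ 2 * w x = ν * w x) →
      ∀ t ∈ Set.Ioo (-1 : ℝ) 1, HasDerivAt (fun x => (w x, w₁ x))
        (w₁ t, ((α * t) ^ 2 - ν) * w t) t := by
    intro w w₁ w₂ h t ht
    have hn : Set.Icc (-1 : ℝ) 1 ∈ nhds t := Icc_mem_nhds ht.1 ht.2
    obtain ⟨h1, h2, h3⟩ := h t (Set.Ioo_subset_Icc_self ht)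
    have h4 : w₂ t = ((α * t) ^ 2 - ν) * w t := by linear_combination -h3
    exact (h1.hasDerivAt hn).prodMk (h4 ▸ h2.hasDerivAt hn)
  set K : ℝ≥0 := ‖α‖₊ ^ 2 + ‖ν‖₊ + 1
  have lip : ∀ t ∈ Set.Ioo (-1 : ℝ) 1, LipschitzOnWith K
      (fun p : ℂ × ℂ => (p.2, ((α * t) ^ 2 - ν) * p.1)) Set.univ := by
    intro t ht
    refine (LipschitzWith.of_dist_le_mul fun p q => ?_).lipschitzOnWith
    have hK : (K : ℝ) = ‖α‖ ^ 2 + ‖ν‖ + 1 := by simp [K]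
    have hQ : ‖(α * t) ^ 2 - ν‖ ≤ ‖α‖ ^ 2 + ‖ν‖ := by
      refine (norm_sub_le _ _).trans (add_le_add_left ?_ _)
      rw [norm_pow, norm_mul, Complex.norm_real, mul_pow]
      have : ‖t‖ ^ 2 ≤ 1 := by
        rw [Real.norm_eq_abs, sq_abs]; nlinarith [ht.1, ht.2]
      exact mul_le_of_le_one_right (by positivity) this
    rw [hK, Prod.dist_eq]
    have hd : 0 ≤ dist p q := dist_nonneg
    have h1 : dist p.1 q.1 ≤ dist p q := le_max_left _ _
    have h2 : dist p.2 q.2 ≤ dist p q := le_max_right _ _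
    refine max_le ?_ ?_
    · have : 0 ≤ (‖α‖ ^ 2 + ‖ν‖) * dist p q := by positivity
      dsimp only
      linarith
    · dsimp only
      rw [dist_eq_norm, ← mul_sub, norm_mul, ← dist_eq_norm p.1 q.1]
      have := mul_le_mul hQ h1 dist_nonneg (by positivity)
      linarith
  have h := ODE_solution_unique_of_mem_Icc (v := fun t p => (p.2, ((α * t) ^ 2 - ν) * p.1))
    (s := fun _ => Set.univ) (t₀ := 0) lip (by norm_num) (cont hu) (der hu) (fun _ _ => trivial)
    (cont hv) (der hv) (fun _ _ => trivial) (by simp [hu0, hu10, hv0, hv10])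
  exact fun x hx => congrArg Prod.fst (h hx)

/-! ### Bounds for the corrector in the right half-plane -/

theorem norm_exp_mul_ofReal_sq (α : ℂ) (x : ℝ) :
    ‖Complex.exp (α * (x : ℂ) ^ 2)‖ = Real.exp (α.re * x ^ 2) := by
  rw [Complex.norm_exp]
  congr 1
  rw [← Complex.ofReal_pow, Complex.re_mul_ofReal]

theorem hasDerivAt_exp_neg_mul_evenCorrectorDeriv (α μ : ℂ) (x : ℝ) :
    HasDerivAt (fun x : ℝ => Complex.exp (-α * (x : ℂ) ^ 2) * evenCorrectorDeriv α μ x)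
      (Complex.exp (-α * (x : ℂ) ^ 2) * (1 - μ * evenCorrector α μ x)) x := by
  have h1 := (((hasDerivAt_pow 2 (x : ℂ)).const_mul (-α)).cexp).comp_ofReal
  refine (h1.mul (hasDerivAt_evenCorrectorDeriv α μ x)).congr_deriv ?_
  push_cast
  ring

theorem norm_evenCorrectorDeriv_le {α μ : ℂ} {N : ℝ}
    (hN : ∀ s ∈ Set.Icc (0 : ℝ) 1, ‖evenCorrector α μ s‖ ≤ N * Real.exp (α.re * s ^ 2))
    (hα : 0 < α.re) {t : ℝ} (ht : t ∈ Set.Icc (0 : ℝ) 1) :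
    ‖evenCorrectorDeriv α μ t‖ ≤ (1 + ‖μ‖ * N) * t * Real.exp (α.re * t ^ 2) := by
  have h := norm_image_sub_le_of_norm_deriv_le_segment' (a := 0) (b := 1) (C := 1 + ‖μ‖ * N)
    (fun x _ => (hasDerivAt_exp_neg_mul_evenCorrectorDeriv α μ x).hasDerivWithinAt)
    (fun x hx => by
      have hxe : Real.exp (-α.re * x ^ 2) ≤ 1 := by
        rw [Real.exp_le_one_iff]; nlinarith [mul_nonneg hα.le (sq_nonneg x)]
      have he : Real.exp (-α.re * x ^ 2) * Real.exp (α.re * x ^ 2) = 1 := by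
        rw [← Real.exp_add]; simp
      rw [norm_mul, norm_exp_mul_ofReal_sq, Complex.neg_re]
      have h1 : ‖1 - μ * evenCorrector α μ x‖ ≤ 1 + ‖μ‖ * (N * Real.exp (α.re * x ^ 2)) := by
        refine (norm_sub_le _ _).trans ?_
        rw [norm_one, norm_mul]
        exact add_le_add_right (mul_le_mul_of_nonneg_left (hN x (Set.Ico_subset_Icc_self hx))
          (norm_nonneg _)) _
      calc Real.exp (-α.re * x ^ 2) * ‖1 - μ * evenCorrector α μ x‖
          ≤ Real.exp (-α.re * x ^ 2) * (1 + ‖μ‖ * (N * Real.exp (α.re * x ^ 2))) :=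
            mul_le_mul_of_nonneg_left h1 (Real.exp_pos _).le
        _ = Real.exp (-α.re * x ^ 2) +
            ‖μ‖ * N * (Real.exp (-α.re * x ^ 2) * Real.exp (α.re * x ^ 2)) := by ring
        _ ≤ 1 + ‖μ‖ * N := by rw [he, mul_one]; linarith) t ht
  simp only [evenCorrectorDeriv_zero, mul_zero, sub_zero] at h
  rw [norm_mul, norm_exp_mul_ofReal_sq, Complex.neg_re, neg_mul, Real.exp_neg,
    inv_mul_le_iff₀ (Real.exp_pos _)] at h
  linarith

theorem norm_evenCorrector_le_of_le {α μ : ℂ} {N : ℝ} (hN0 : 0 ≤ N)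
    (hN : ∀ s ∈ Set.Icc (0 : ℝ) 1, ‖evenCorrector α μ s‖ ≤ N * Real.exp (α.re * s ^ 2))
    (hα : 0 < α.re) {x : ℝ} (hx : x ∈ Set.Icc (0 : ℝ) 1) :
    ‖evenCorrector α μ x‖ ≤ (1 + ‖μ‖ * N) * (Real.exp (α.re * x ^ 2) / (2 * α.re)) := by
  refine image_norm_le_of_norm_deriv_right_le_deriv_boundary (a := 0) (b := 1)
    (B := fun x => (1 + ‖μ‖ * N) * (Real.exp (α.re * x ^ 2) / (2 * α.re)))
    (B' := fun x => (1 + ‖μ‖ * N) * x * Real.exp (α.re * x ^ 2))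
    (fun x _ => (hasDerivAt_evenCorrector α μ x).continuousAt.continuousWithinAt)
    (fun x _ => (hasDerivAt_evenCorrector α μ x).hasDerivWithinAt) ?_ (fun x => ?_)
    (fun x hx => norm_evenCorrectorDeriv_le hN hα (Set.Ico_subset_Icc_self hx)) hx
  · rw [evenCorrector_zero, norm_zero]; positivity
  · refine (((((hasDerivAt_pow 2 x).const_mul α.re).exp).div_const (2 * α.re)).const_mul
      (1 + ‖μ‖ * N)).congr_deriv ?_
    push_cast
    field_simp

/-- A bound that closes on itself: if `N` is the maximum of `|g(x)| e^{-x² Re α}` on `[0, 1]`, then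
integrating `g'' - 2αx g' = 1 - μ g` twice gives `N ≤ (1 + |μ| N) / (2 Re α)`. -/
theorem norm_evenCorrector_le {α μ : ℂ} (hα : 0 < α.re) (hμ : ‖μ‖ ≤ α.re) {x : ℝ}
    (hx : x ∈ Set.Icc (0 : ℝ) 1) :
    ‖evenCorrector α μ x‖ ≤ Real.exp (α.re * x ^ 2) / α.re := by
  have hcont : Continuous fun s : ℝ => ‖evenCorrector α μ s‖ / Real.exp (α.re * s ^ 2) := by
    have : Continuous (evenCorrector α μ) :=
      continuous_iff_continuousAt.2 fun s => (hasDerivAt_evenCorrector α μ s).continuousAt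
    exact this.norm.div (by fun_prop) fun s => (Real.exp_pos _).ne'
  obtain ⟨s, hs, hmax⟩ := isCompact_Icc.exists_isMaxOn (s := Set.Icc (0 : ℝ) 1)
    ⟨0, by simp⟩ hcont.continuousOn
  set N := ‖evenCorrector α μ s‖ / Real.exp (α.re * s ^ 2) with hNdef
  have hN0 : 0 ≤ N := by positivity
  have hN : ∀ t ∈ Set.Icc (0 : ℝ) 1, ‖evenCorrector α μ t‖ ≤ N * Real.exp (α.re * t ^ 2) := by
    intro t ht
    rw [← div_le_iff₀ (Real.exp_pos _)]
    exact hmax ht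
  have h1 : N ≤ (1 + ‖μ‖ * N) / (2 * α.re) := by
    rw [hNdef, div_le_iff₀ (Real.exp_pos _), ← hNdef]
    refine (norm_evenCorrector_le_of_le hN0 hN hα hs).trans (le_of_eq ?_)
    ring
  have h2 : N ≤ 1 / α.re := by
    rw [le_div_iff₀ (by positivity)] at h1 ⊢
    nlinarith [mul_le_mul_of_nonneg_right hμ hN0]
  refine (hN x hx).trans ?_
  rw [div_eq_inv_mul, ← one_div]
  exact mul_le_mul_of_nonneg_right h2 (Real.exp_pos _).le

theorem norm_evenCorrector_one_le {α μ : ℂ} (hα : 0 < α.re) (hμ : ‖μ‖ ≤ α.re) :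
    ‖evenCorrector α μ 1‖ ≤ Real.exp α.re / α.re := by
  simpa using norm_evenCorrector_le hα hμ (x := 1) (by simp)

theorem differentiable_evenCorrector_right (α : ℂ) (x : ℝ) :
    Differentiable ℂ fun μ => evenCorrector α μ x := by
  rw [← differentiableOn_univ]
  exact differentiableOn_corrector isOpen_univ (differentiableOn_const α) differentiableOn_id _

/-- Cauchy's estimate, applied to `norm_evenCorrector_one_le`, gives Lipschitz dependence
on `μ`. -/
theorem norm_evenCorrector_one_sub_le {α μ ν : ℂ} (hα : 0 < α.re) (hμ : ‖μ‖ ≤ α.re / 2)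
    (hν : ‖ν‖ ≤ α.re / 2) : ‖evenCorrector α μ 1 - evenCorrector α ν 1‖ ≤
      2 * Real.exp α.re / α.re ^ 2 * ‖μ - ν‖ := by
  refine Convex.norm_image_sub_le_of_norm_deriv_le (𝕜 := ℂ)
    (f := fun μ => evenCorrector α μ 1) (s := Metric.closedBall 0 (α.re / 2))
    (fun w _ => differentiable_evenCorrector_right α 1 w) (fun w hw => ?_)
    (convex_closedBall _ _) (by simpa using hν) (by simpa using hμ)
  have h := Complex.norm_deriv_le_of_forall_mem_sphere_norm_le (c := w) (R := α.re / 2)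
    (C := Real.exp α.re / α.re) (f := fun μ => evenCorrector α μ 1) (by positivity)
    (differentiable_evenCorrector_right α 1).diffContOnCl (fun z hz => by
      refine norm_evenCorrector_one_le hα ?_
      rw [mem_sphere_iff_norm] at hz
      rw [mem_closedBall_zero_iff] at hw
      have := norm_add_le (z - w) w
      rw [sub_add_cancel] at this
      linarith)
  refine h.trans (le_of_eq ?_)
  field_simp

/-! ### A lower bound for the corrector -/

/-- A region that contains every sector `|arg α| < θ < π/2` up to a bounded set, and in which the
asymptotics of the corrector hold uniformly. -/
def asymptoticRegion : Set ℂ := {α | 100 < α.re ∧ 100 * (‖α‖ * √‖α‖) < α.re ^ 2}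

theorem isOpen_asymptoticRegion : IsOpen asymptoticRegion :=
  (isOpen_lt continuous_const Complex.continuous_re).inter
    (isOpen_lt (by fun_prop : Continuous fun α : ℂ => 100 * (‖α‖ * √‖α‖))
      (by fun_prop : Continuous fun α : ℂ => α.re ^ 2))

theorem evenCorrectorDeriv_one_eq (α : ℂ) : evenCorrectorDeriv α 0 1 =
    Complex.exp α * ∫ s in (0 : ℝ)..1, Complex.exp (-α * (s : ℂ) ^ 2) := by
  have h := intervalIntegral.integral_eq_sub_of_hasDerivAt (a := 0) (b := 1)
    (f := fun x : ℝ => Complex.exp (-α * (x : ℂ) ^ 2) * evenCorrectorDeriv α 0 x)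
    (f' := fun x : ℝ => Complex.exp (-α * (x : ℂ) ^ 2))
    (fun x _ => by simpa using hasDerivAt_exp_neg_mul_evenCorrectorDeriv α 0 x)
    ((by fun_prop : Continuous _).intervalIntegrable _ _)
  rw [h, evenCorrectorDeriv_zero, mul_zero, sub_zero, ← mul_assoc, ← Complex.exp_add]
  simp

theorem norm_integral_exp_neg_sq_ge {α : ℂ} (hα : 0 < α.re) :
    √Real.pi / (2 * √‖α‖) - Real.exp (-α.re) / α.re ≤
      ‖∫ s in (0 : ℝ)..1, Complex.exp (-α * (s : ℂ) ^ 2)‖ := by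
  have hint : IntegrableOn (fun s : ℝ => Complex.exp (-α * (s : ℂ) ^ 2)) (Set.Ioi 0) :=
    (integrable_cexp_neg_mul_sq hα).integrableOn
  have hsplit := intervalIntegral.integral_interval_add_Ioi hint
    (hint.mono_set (Set.Ioi_subset_Ioi zero_le_one))
  rw [integral_gaussian_complex_Ioi hα] at hsplit
  have htail : ‖∫ s in Set.Ioi (1 : ℝ), Complex.exp (-α * (s : ℂ) ^ 2)‖ ≤
      Real.exp (-α.re) / α.re := by
    have h := integral_exp_mul_Ioi (a := -α.re) (by linarith) 1
    rw [mul_one, neg_div_neg_eq] at h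
    rw [← h]
    refine norm_integral_le_of_norm_le (integrableOn_exp_mul_Ioi (by linarith) 1) ?_
    refine (ae_restrict_iff' measurableSet_Ioi).2 (Filter.Eventually.of_forall fun s hs => ?_)
    rw [norm_exp_mul_ofReal_sq, Complex.neg_re]
    have hs1 : (1 : ℝ) < s := hs
    refine Real.exp_le_exp.2 ?_
    nlinarith [mul_pos hα (mul_pos (by linarith : 0 < s) (by linarith : 0 < s - 1))]
  have hmain : ‖((Real.pi : ℂ) / α) ^ (1 / 2 : ℂ) / 2‖ = √Real.pi / (2 * √‖α‖) := by
    rw [norm_div, show (1 / 2 : ℂ) = ((1 / 2 : ℝ) : ℂ) by push_cast; ring,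
      Complex.norm_cpow_real, norm_div, Complex.norm_real, Real.norm_of_nonneg Real.pi_pos.le,
      ← Real.sqrt_eq_rpow, Real.sqrt_div Real.pi_pos.le, Complex.norm_ofNat]
    field_simp
  rw [← hmain, ← hsplit]
  have := norm_add_le (∫ s in (0 : ℝ)..1, Complex.exp (-α * (s : ℂ) ^ 2))
    (∫ s in Set.Ioi (1 : ℝ), Complex.exp (-α * (s : ℂ) ^ 2))
  linarith

/-- Integrating by parts, `2α g(1) = g'(1) - 1` up to the term `2α ∫₀¹ g`, which is of
lower order. -/
theorem norm_evenCorrectorDeriv_one_sub_le {α : ℂ} (hα : 0 < α.re) :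
    ‖evenCorrectorDeriv α 0 1 - 1 - 2 * α * evenCorrector α 0 1‖ ≤
      ‖α‖ * Real.exp α.re / α.re ^ 2 := by
  have hN : ∀ s ∈ Set.Icc (0 : ℝ) 1,
      ‖evenCorrector α 0 s‖ ≤ 1 / α.re * Real.exp (α.re * s ^ 2) := fun s hs =>
    (norm_evenCorrector_le hα (by simpa using hα.le) hs).trans (le_of_eq (by ring))
  have hx : ∀ x : ℝ, HasDerivAt (fun x : ℝ => (x : ℂ)) 1 x := fun x =>
    (hasDerivAt_id (x : ℂ)).comp_ofReal
  have hder : ∀ x : ℝ, HasDerivAt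
      (fun x : ℝ => evenCorrectorDeriv α 0 x - x - 2 * α * x * evenCorrector α 0 x)
      (-(2 * α * evenCorrector α 0 x)) x := by
    intro x
    refine (((hasDerivAt_evenCorrectorDeriv α 0 x).sub (hx x)).sub
      (((hx x).const_mul (2 * α)).mul (hasDerivAt_evenCorrector α 0 x))).congr_deriv ?_
    ring
  have h := image_norm_le_of_norm_deriv_right_le_deriv_boundary (a := 0) (b := 1)
    (B := fun x => ‖α‖ * Real.exp (α.re * x) / α.re ^ 2)
    (B' := fun x => ‖α‖ * Real.exp (α.re * x) / α.re)
    (fun x _ => (hder x).continuousAt.continuousWithinAt)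
    (fun x _ => (hder x).hasDerivWithinAt)
    (by simp [evenCorrectorDeriv_zero]; positivity)
    (fun x => by
      refine (((((hasDerivAt_id x).const_mul α.re).exp).const_mul ‖α‖).div_const
        (α.re ^ 2)).congr_deriv ?_
      simp only [id]
      field_simp)
    (fun x hx => by
      have h1 := norm_evenCorrector_le_of_le (by positivity) hN hα (Set.Ico_subset_Icc_self hx)
      rw [norm_zero, zero_mul, add_zero, one_mul] at h1
      have h2 : Real.exp (α.re * x ^ 2) ≤ Real.exp (α.re * x) :=
        Real.exp_le_exp.2 (mul_le_mul_of_nonneg_left (by nlinarith [hx.1, hx.2]) hα.le)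
      rw [norm_neg, norm_mul, norm_mul, Complex.norm_ofNat]
      calc 2 * ‖α‖ * ‖evenCorrector α 0 x‖
          ≤ 2 * ‖α‖ * (Real.exp (α.re * x) / (2 * α.re)) := by
            refine mul_le_mul_of_nonneg_left (h1.trans ?_) (by positivity)
            gcongr
        _ = ‖α‖ * Real.exp (α.re * x) / α.re := by field_simp)
    (x := 1) (by simp)
  simpa using h

theorem norm_evenCorrector_zero_one_ge {α : ℂ} (hα : α ∈ asymptoticRegion) :
    Real.exp α.re / (4 * (‖α‖ * √‖α‖)) ≤ ‖evenCorrector α 0 1‖ := by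
  obtain ⟨hb, hA⟩ := hα
  have hb0 : 0 < α.re := by linarith
  have hAb : α.re ≤ ‖α‖ := Complex.re_le_norm α
  set b := α.re
  set A := ‖α‖
  set s := √A
  have hA0 : 0 < A := by linarith
  have hs0 : 0 < s := Real.sqrt_pos.2 hA0
  set e := Real.exp b
  have he : b ^ 2 / 2 ≤ e := by have := Real.quadratic_le_exp_of_nonneg hb0.le; linarith
  have he0 : 0 < e := Real.exp_pos b
  have hpi : (1.76 : ℝ) ≤ √Real.pi := Real.le_sqrt_of_sq_le (by nlinarith [Real.pi_gt_d2])
  have h1 : e * (√Real.pi / (2 * s) - e⁻¹ / b) ≤ ‖evenCorrectorDeriv α 0 1‖ := by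
    rw [evenCorrectorDeriv_one_eq, norm_mul, Complex.norm_exp, ← Real.exp_neg]
    exact mul_le_mul_of_nonneg_left (norm_integral_exp_neg_sq_ge hb0) he0.le
  have h1' : e * (√Real.pi / (2 * s)) - 1 / b ≤ ‖evenCorrectorDeriv α 0 1‖ := by
    refine le_trans (le_of_eq ?_) h1
    field_simp
  have h2 : ‖evenCorrectorDeriv α 0 1‖ ≤ A * e / b ^ 2 + 1 + 2 * A * ‖evenCorrector α 0 1‖ := by
    have h3 := norm_evenCorrectorDeriv_one_sub_le hb0
    have h4 : evenCorrectorDeriv α 0 1 = (evenCorrectorDeriv α 0 1 - 1 -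
        2 * α * evenCorrector α 0 1) + 1 + 2 * α * evenCorrector α 0 1 := by ring
    rw [h4]
    refine (norm_add₃_le).trans ?_
    rw [norm_one, norm_mul, norm_mul, Complex.norm_ofNat]
    linarith
  have h5 : A * e / b ^ 2 ≤ e / (100 * s) := by
    rw [div_le_div_iff₀ (by positivity) (by positivity)]
    nlinarith
  have h6 : 1 + 1 / b ≤ e / (10 * s) := by
    have h7 : 1 / b ≤ 1 := by rw [div_le_one hb0]; linarith
    have h8 : 20 * s ≤ e := by nlinarith
    rw [le_div_iff₀ (by positivity)]
    nlinarith
  have h9 : 0.88 * (e / s) ≤ e * (√Real.pi / (2 * s)) := by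
    rw [show e * (√Real.pi / (2 * s)) = √Real.pi / 2 * (e / s) by field_simp]
    exact mul_le_mul_of_nonneg_right (by linarith) (by positivity)
  have h10 : e / (100 * s) = 0.01 * (e / s) := by field_simp; norm_num
  have h11 : e / (10 * s) = 0.1 * (e / s) := by field_simp; norm_num
  have h12 : 0.77 * (e / s) ≤ 2 * A * ‖evenCorrector α 0 1‖ := by linarith
  rw [show e / (4 * (A * s)) = (e / s) / (4 * A) by field_simp, div_le_iff₀ (by positivity)]
  have : 0 < e / s := by positivity
  linarith

/-! ### The small root of the eigenvalue equation -/

theorem norm_evenCorrector_one_ge {α μ : ℂ} (hα : α ∈ asymptoticRegion) (hμ : ‖μ‖ ≤ 1 / 4) :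
    Real.exp α.re / (5 * (‖α‖ * √‖α‖)) ≤ ‖evenCorrector α μ 1‖ := by
  obtain ⟨hb, hA⟩ := id hα
  have hb0 : 0 < α.re := by linarith
  have hA0 : 0 < ‖α‖ := hb0.trans_le (Complex.re_le_norm α)
  have hs0 : 0 < √‖α‖ := Real.sqrt_pos.2 hA0
  have h1 := norm_evenCorrector_zero_one_ge hα
  have h2 := norm_evenCorrector_one_sub_le (μ := 0) (ν := μ) hb0 (by rw [norm_zero]; linarith)
    (by linarith)
  have h3 := norm_sub_norm_le (evenCorrector α 0 1) (evenCorrector α μ 1)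
  rw [zero_sub, norm_neg] at h2
  set e := Real.exp α.re
  have he0 : 0 < e := Real.exp_pos _
  set D := ‖α‖ * √‖α‖
  have hD0 : 0 < D := by positivity
  have h4 : 2 * e / α.re ^ 2 * ‖μ‖ ≤ 1 / 200 * (e / D) := by
    calc 2 * e / α.re ^ 2 * ‖μ‖ ≤ 2 * e / α.re ^ 2 * (1 / 4) := by gcongr
      _ = e / (2 * α.re ^ 2) := by field_simp; norm_num
      _ ≤ e / (200 * D) := by refine div_le_div_of_nonneg_left he0.le (by positivity) (by linarith)
      _ = 1 / 200 * (e / D) := by field_simp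
  have h5 : e / (4 * D) = 1 / 4 * (e / D) := by field_simp
  have h6 : e / (5 * D) = 1 / 5 * (e / D) := by field_simp
  have h7 : 0 < e / D := by positivity
  linarith

theorem evenCorrector_one_ne_zero {α μ : ℂ} (hα : α ∈ asymptoticRegion) (hμ : ‖μ‖ ≤ 1 / 4) :
    evenCorrector α μ 1 ≠ 0 := by
  have hA0 : 0 < ‖α‖ := lt_of_lt_of_le (by linarith [hα.1]) (Complex.re_le_norm α)
  have hs0 : 0 < √‖α‖ := Real.sqrt_pos.2 hA0
  exact norm_pos_iff.1 (lt_of_lt_of_le (by positivity) (norm_evenCorrector_one_ge hα hμ))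

theorem norm_inv_evenCorrector_one_le {α μ : ℂ} (hα : α ∈ asymptoticRegion) (hμ : ‖μ‖ ≤ 1 / 4) :
    ‖(evenCorrector α μ 1)⁻¹‖ ≤ 5 * (‖α‖ * √‖α‖) * Real.exp (-α.re) := by
  have hA0 : 0 < ‖α‖ := lt_of_lt_of_le (by linarith [hα.1]) (Complex.re_le_norm α)
  have hs0 : 0 < √‖α‖ := Real.sqrt_pos.2 hA0
  rw [norm_inv, Real.exp_neg]
  refine (inv_anti₀ (by positivity) (norm_evenCorrector_one_ge hα hμ)).trans (le_of_eq ?_)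
  field_simp

theorem five_mul_exp_neg_le {α : ℂ} (hα : α ∈ asymptoticRegion) :
    5 * (‖α‖ * √‖α‖) * Real.exp (-α.re) ≤ 1 / 4 := by
  obtain ⟨hb, hA⟩ := hα
  have he : α.re ^ 2 / 2 ≤ Real.exp α.re := by
    have := Real.quadratic_le_exp_of_nonneg (show 0 ≤ α.re by linarith); linarith
  rw [Real.exp_neg, mul_inv_le_iff₀ (Real.exp_pos _)]
  nlinarith

theorem norm_inv_evenCorrector_one_sub_le {α μ ν : ℂ} (hα : α ∈ asymptoticRegion)
    (hμ : ‖μ‖ ≤ 1 / 4) (hν : ‖ν‖ ≤ 1 / 4) :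
    ‖(evenCorrector α μ 1)⁻¹ - (evenCorrector α ν 1)⁻¹‖ ≤ 1 / 2 * ‖μ - ν‖ := by
  obtain ⟨hb, hA⟩ := id hα
  have hb0 : 0 < α.re := by linarith
  have hH := evenCorrector_one_ne_zero hα hμ
  have hH' := evenCorrector_one_ne_zero hα hν
  have h1 := norm_evenCorrector_one_sub_le (μ := μ) (ν := ν) hb0 (by linarith) (by linarith)
  have h2 := norm_inv_evenCorrector_one_le hα hμ
  have h3 := norm_inv_evenCorrector_one_le hα hν
  have he : α.re ^ 2 / 2 ≤ Real.exp α.re := by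
    have := Real.quadratic_le_exp_of_nonneg (show 0 ≤ α.re by linarith); linarith
  rw [inv_sub_inv hH hH', norm_div, norm_mul, norm_sub_rev, div_eq_mul_inv, mul_inv, ← norm_inv,
    ← norm_inv]
  rw [Real.exp_neg] at h2 h3
  set e := Real.exp α.re
  have he0 : 0 < e := Real.exp_pos _
  set D := ‖α‖ * √‖α‖
  have hD0 : 0 ≤ D := by positivity
  have h4 : 2 * e / α.re ^ 2 * (5 * D * e⁻¹ * (5 * D * e⁻¹)) ≤ 1 / 2 := by
    rw [show 2 * e / α.re ^ 2 * (5 * D * e⁻¹ * (5 * D * e⁻¹)) = 50 * (D * D) / (α.re ^ 2 * e) by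
      field_simp; ring, div_le_iff₀ (by positivity)]
    have h5 : D * D ≤ (α.re ^ 2 / 100) * (α.re ^ 2 / 100) :=
      mul_self_le_mul_self hD0 (by linarith)
    nlinarith [mul_le_mul_of_nonneg_left he (sq_nonneg α.re)]
  calc ‖evenCorrector α μ 1 - evenCorrector α ν 1‖ *
        (‖(evenCorrector α μ 1)⁻¹‖ * ‖(evenCorrector α ν 1)⁻¹‖)
      ≤ 2 * e / α.re ^ 2 * ‖μ - ν‖ * (5 * D * e⁻¹ * (5 * D * e⁻¹)) := by gcongr
    _ = 2 * e / α.re ^ 2 * (5 * D * e⁻¹ * (5 * D * e⁻¹)) * ‖μ - ν‖ := by ring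
    _ ≤ 1 / 2 * ‖μ - ν‖ := mul_le_mul_of_nonneg_right h4 (norm_nonneg _)

theorem eq_of_mul_evenCorrector_one_eq_one {α μ ν : ℂ} (hα : α ∈ asymptoticRegion)
    (hμ : ‖μ‖ ≤ 1 / 4) (hν : ‖ν‖ ≤ 1 / 4) (h : μ * evenCorrector α μ 1 = 1)
    (h' : ν * evenCorrector α ν 1 = 1) : μ = ν := by
  have h1 := norm_inv_evenCorrector_one_sub_le hα hμ hν
  rw [← eq_inv_of_mul_eq_one_left h, ← eq_inv_of_mul_eq_one_left h'] at h1
  exact sub_eq_zero.1 (norm_eq_zero.1 (by linarith [norm_nonneg (μ - ν)]))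

/-- The iterates from `0` of the contraction `μ ↦ 1 / k(1)`. -/
noncomputable def rootIterate : ℕ → ℂ → ℂ
  | 0 => fun _ => 0
  | n + 1 => fun α => (evenCorrector α (rootIterate n α) 1)⁻¹

theorem norm_rootIterate_le {α : ℂ} (hα : α ∈ asymptoticRegion) (n : ℕ) :
    ‖rootIterate n α‖ ≤ 1 / 4 := by
  induction n with
  | zero => simp [rootIterate]
  | succ n ih => exact (norm_inv_evenCorrector_one_le hα ih).trans (five_mul_exp_neg_le hα)

theorem dist_rootIterate_succ_le {α : ℂ} (hα : α ∈ asymptoticRegion) (n : ℕ) :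
    dist (rootIterate n α) (rootIterate (n + 1) α) ≤ 1 * (1 / 2) ^ n := by
  induction n with
  | zero =>
    have h := norm_rootIterate_le hα 1
    rw [dist_eq_norm, show rootIterate 0 α = 0 from rfl, zero_sub, norm_neg]
    norm_num at h ⊢
    linarith
  | succ n ih =>
    rw [dist_eq_norm] at ih ⊢
    have h := norm_inv_evenCorrector_one_sub_le hα (norm_rootIterate_le hα n)
      (norm_rootIterate_le hα (n + 1))
    refine h.trans ?_
    rw [pow_succ]
    linarith

theorem differentiableOn_rootIterate (n : ℕ) :
    DifferentiableOn ℂ (rootIterate n) asymptoticRegion := by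
  induction n with
  | zero => exact differentiableOn_const 0
  | succ n ih =>
    exact (differentiableOn_corrector isOpen_asymptoticRegion differentiableOn_id ih _).inv
      fun α hα => evenCorrector_one_ne_zero hα (norm_rootIterate_le hα n)

/-- The root `μ` of `μ k(1) = 1` near `0` depends holomorphically on `α`, since the contraction
iterates converge uniformly; it is exponentially small. -/
theorem exists_holomorphic_root : ∃ μ : ℂ → ℂ, DifferentiableOn ℂ μ asymptoticRegion ∧
    ∀ α ∈ asymptoticRegion, ‖μ α‖ ≤ 1 / 4 ∧ μ α * evenCorrector α (μ α) 1 = 1 ∧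
      ‖μ α‖ ≤ 5 * (‖α‖ * √‖α‖) * Real.exp (-α.re) := by
  have hlim : ∀ α : ℂ, ∃ l, α ∈ asymptoticRegion →
      Filter.Tendsto (fun n => rootIterate n α) Filter.atTop (nhds l) := by
    intro α
    by_cases hα : α ∈ asymptoticRegion
    · obtain ⟨l, hl⟩ := cauchySeq_tendsto_of_complete
        (cauchySeq_of_le_geometric (1 / 2) 1 (by norm_num) (dist_rootIterate_succ_le hα))
      exact ⟨l, fun _ => hl⟩
    · exact ⟨0, fun h => absurd h hα⟩
  choose μ hμ using hlim
  have hunif : TendstoUniformlyOn rootIterate μ Filter.atTop asymptoticRegion := by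
    rw [Metric.tendstoUniformlyOn_iff]
    intro ε hε
    have h0 : Filter.Tendsto (fun n : ℕ => 1 * (1 / 2 : ℝ) ^ n / (1 - 1 / 2)) Filter.atTop
        (nhds 0) := by
      simpa using ((tendsto_pow_atTop_nhds_zero_of_lt_one (r := (1 / 2 : ℝ)) (by norm_num)
        (by norm_num)).const_mul 1).div_const (1 - 1 / 2)
    filter_upwards [h0.eventually (gt_mem_nhds hε)] with n hn α hα
    rw [dist_comm]
    exact (dist_le_of_le_geometric_of_tendsto (1 / 2) 1 (by norm_num)
      (dist_rootIterate_succ_le hα) (hμ α hα) n).trans_lt hn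
  refine ⟨μ, hunif.tendstoLocallyUniformlyOn.differentiableOn
    (Filter.Eventually.of_forall differentiableOn_rootIterate) isOpen_asymptoticRegion,
    fun α hα => ?_⟩
  have h1 : ‖μ α‖ ≤ 1 / 4 :=
    le_of_tendsto (hμ α hα).norm (Filter.Eventually.of_forall (norm_rootIterate_le hα))
  have hne := evenCorrector_one_ne_zero hα h1
  have h2 : Filter.Tendsto (fun n => rootIterate (n + 1) α) Filter.atTop
      (nhds (evenCorrector α (μ α) 1)⁻¹) :=
    (((differentiable_evenCorrector_right α 1).continuous.tendsto (μ α)).comp (hμ α hα)).inv₀ hne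
  have h3 : μ α = (evenCorrector α (μ α) 1)⁻¹ :=
    tendsto_nhds_unique ((Filter.tendsto_add_atTop_iff_nat 1).2 (hμ α hα)) h2
  refine ⟨h1, ?_, ?_⟩
  · nth_rewrite 1 [h3]
    exact inv_mul_cancel₀ hne
  · rw [h3]
    exact norm_inv_evenCorrector_one_le hα h1

/-! ### Dirichlet eigenfunctions -/

/-- By elliptic regularity in one dimension, eigenfunctions are classical solutions. -/
theorem IsDirichletEigenfunction.exists_hasDerivWithinAt {α ν : ℂ} {u : ℝ → ℂ}
    (hu : IsDirichletEigenfunction α ν u) : u (-1) = 0 ∧ u 1 = 0 ∧ ∃ u₁ : ℝ → ℂ,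
      ∀ x ∈ Set.Icc (-1 : ℝ) 1, HasDerivWithinAt u (u₁ x) (Set.Icc (-1) 1) x ∧
        HasDerivWithinAt u₁ (((α * x) ^ 2 - ν) * u x) (Set.Icc (-1) 1) x := by
  obtain ⟨-, u₁, u₂, ⟨hL, h1, h0, hr⟩, heq⟩ := hu
  have hle : (-1 : ℝ) ≤ 1 := by norm_num
  have hprim : ∀ {f F : ℝ → ℂ} {c : ℂ}, ContinuousOn f (Set.Icc (-1) 1) →
      (∀ x ∈ Set.Icc (-1 : ℝ) 1, F x = c + ∫ t in (-1 : ℝ)..x, f t) →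
      ∀ x ∈ Set.Icc (-1 : ℝ) 1, HasDerivWithinAt F (f x) (Set.Icc (-1) 1) x := by
    intro f F c hf hF x hx
    have : Fact (x ∈ Set.Icc (-1 : ℝ) 1) := ⟨hx⟩
    have hsub : Set.uIcc (-1 : ℝ) x ⊆ Set.Icc (-1) 1 := by
      rw [Set.uIcc_of_le hx.1]; exact Set.Icc_subset_Icc_right hx.2
    have h := intervalIntegral.integral_hasDerivWithinAt_right (a := -1) (b := x) (f := f)
      (s := Set.Icc (-1) 1) (t := Set.Icc (-1) 1)
      ((hf.mono hsub).intervalIntegrable)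
      (hf.stronglyMeasurableAtFilter_nhdsWithin measurableSet_Icc x) (hf x hx)
    exact (h.const_add c).congr (fun y hy => hF y hy) (hF x hx)
  have hint : IntegrableOn u₂ (Set.Icc (-1) 1) := by
    rw [integrableOn_Icc_iff_integrableOn_Ioo]
    exact hL.integrable (by norm_num)
  have hc1 : ContinuousOn u₁ (Set.Icc (-1) 1) := by
    have h := intervalIntegral.continuousOn_primitive_interval (μ := volume) (a := -1) (b := 1)
      (f := u₂) (by rwa [Set.uIcc_of_le hle])
    rw [Set.uIcc_of_le hle] at h
    exact (continuousOn_const.add h).congr h1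
  have hd0 := hprim (F := u) (c := 0) hc1 (fun x hx => by rw [zero_add]; exact h0 x hx)
  have hc0 : ContinuousOn u (Set.Icc (-1) 1) := fun x hx => (hd0 x hx).continuousWithinAt
  have hcq : ContinuousOn (fun x : ℝ => ((α * x) ^ 2 - ν) * u x) (Set.Icc (-1) 1) :=
    (by fun_prop : Continuous fun x : ℝ => ((α * x) ^ 2 - ν)).continuousOn.mul hc0
  refine ⟨?_, hr, u₁, fun x hx => ⟨hd0 x hx, hprim (c := u₁ (-1)) hcq (fun y hy => ?_) x hx⟩⟩
  · rw [h0 (-1) (by norm_num)]; simp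
  · rw [h1 y hy]
    congr 1
    rw [intervalIntegral.integral_of_le hy.1, intervalIntegral.integral_of_le hy.1,
      integral_Ioc_eq_integral_Ioo, integral_Ioc_eq_integral_Ioo]
    refine integral_congr_ae ?_
    refine ae_mono (Measure.restrict_mono (Set.Ioo_subset_Ioo_right hy.2) le_rfl) ?_
    filter_upwards [heq] with t ht
    linear_combination -ht

/-- A normalized solution that vanishes at `±1` is an eigenfunction. -/
theorem IsNormalizedSolution.isDirichletEigenfunction {α ν : ℂ} {v : ℝ → ℂ}
    (hv : IsNormalizedSolution α ν v) (hl : v (-1) = 0) (hr : v 1 = 0) :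
    IsDirichletEigenfunction α ν v := by
  obtain ⟨v₁, v₂, hv0, -, hv⟩ := hv
  have hle : (-1 : ℝ) ≤ 1 := by norm_num
  have hc0 : ContinuousOn v (Set.Icc (-1) 1) := fun x hx => (hv x hx).1.continuousWithinAt
  have hc1 : ContinuousOn v₁ (Set.Icc (-1) 1) := fun x hx => (hv x hx).2.1.continuousWithinAt
  have hc2 : ContinuousOn v₂ (Set.Icc (-1) 1) := by
    refine ((by fun_prop : Continuous fun x : ℝ => ((α * x) ^ 2 - ν)).continuousOn.mul
      hc0).congr fun x hx => ?_
    simp only [Pi.mul_apply]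
    linear_combination -(hv x hx).2.2
  have ftc : ∀ {F f : ℝ → ℂ}, ContinuousOn f (Set.Icc (-1) 1) →
      (∀ x ∈ Set.Icc (-1 : ℝ) 1, HasDerivWithinAt F (f x) (Set.Icc (-1) 1) x) →
      ∀ x ∈ Set.Icc (-1 : ℝ) 1, F x = F (-1) + ∫ t in (-1 : ℝ)..x, f t := by
    intro F f hf hF x hx
    have hsub : Set.Icc (-1 : ℝ) x ⊆ Set.Icc (-1) 1 := Set.Icc_subset_Icc_right hx.2
    rw [intervalIntegral.integral_eq_sub_of_hasDerivAt_of_le hx.1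
      (fun y hy => ((hF y (hsub hy)).continuousWithinAt).mono hsub)
      (fun y hy => (hF y (hsub (Set.Ioo_subset_Icc_self hy))).hasDerivAt
        (Icc_mem_nhds hy.1 (hy.2.trans_le hx.2)))
      ((hf.mono (by rwa [Set.uIcc_of_le hx.1])).intervalIntegrable)]
    ring
  refine ⟨⟨0, by norm_num, by simp [hv0]⟩, v₁, v₂, ⟨?_, ftc hc2 fun x hx => (hv x hx).2.1,
    fun x hx => ?_, hr⟩, ?_⟩
  · obtain ⟨C, hC⟩ := isCompact_Icc.exists_bound_of_continuousOn hc2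
    refine MemLp.of_bound ((hc2.mono Set.Ioo_subset_Icc_self).aestronglyMeasurable
      measurableSet_Ioo) C ?_
    exact (ae_restrict_iff' measurableSet_Ioo).2
      (Filter.Eventually.of_forall fun x hx => hC x (Set.Ioo_subset_Icc_self hx))
  · rw [ftc hc1 (fun y hy => (hv y hy).1) x hx, hl, zero_add]
  · exact (ae_restrict_iff' measurableSet_Ioo).2
      (Filter.Eventually.of_forall fun x hx => (hv x (Set.Ioo_subset_Icc_self hx)).2.2)

/-- Jacobi's form of the variational bound: if `ψ` satisfies the Riccati inequality
`ψ' + ψ² ≤ (ax)² - κ`, then the equation with `ν < κ` has no nontrivial solution that vanishes at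
both ends, since `f f' - ψ f²` would be monotone. -/
theorem eqOn_zero_of_riccati {a ν κ l r : ℝ} (hν : ν < κ) {ψ ψ' f f₁ : ℝ → ℝ}
    (hf : ∀ x ∈ Set.Icc l r, HasDerivWithinAt f (f₁ x) (Set.Icc l r) x)
    (hf₁ : ∀ x ∈ Set.Icc l r, HasDerivWithinAt f₁ (((a * x) ^ 2 - ν) * f x) (Set.Icc l r) x)
    (hψ : ∀ x, HasDerivAt ψ (ψ' x) x)
    (hric : ∀ x ∈ Set.Icc l r, ψ' x + ψ x ^ 2 ≤ (a * x) ^ 2 - κ)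
    (hl : f l = 0) (hr : f r = 0) : ∀ x ∈ Set.Icc l r, f x = 0 := by
  have hder : ∀ x ∈ Set.Icc l r, HasDerivWithinAt (fun x => f x * f₁ x - ψ x * f x ^ 2)
      ((f₁ x - ψ x * f x) ^ 2 + ((a * x) ^ 2 - ν - ψ' x - ψ x ^ 2) * f x ^ 2)
      (Set.Icc l r) x := by
    intro x hx
    refine (((hf x hx).mul (hf₁ x hx)).sub
      ((hψ x).hasDerivWithinAt.mul ((hf x hx).pow 2))).congr_deriv ?_
    simp only [Pi.pow_apply]
    ring
  have hc : ContinuousOn (fun x => f x * f₁ x - ψ x * f x ^ 2) (Set.Icc l r) :=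
    fun x hx => (hder x hx).continuousWithinAt
  have hge : ∀ x ∈ Set.Icc l r, (κ - ν) * f x ^ 2 ≤
      (f₁ x - ψ x * f x) ^ 2 + ((a * x) ^ 2 - ν - ψ' x - ψ x ^ 2) * f x ^ 2 := by
    intro x hx
    nlinarith [hric x hx, sq_nonneg (f x), sq_nonneg (f₁ x - ψ x * f x)]
  have hmono : MonotoneOn (fun x => f x * f₁ x - ψ x * f x ^ 2) (Set.Icc l r) := by
    refine monotoneOn_of_hasDerivWithinAt_nonneg (convex_Icc l r) hc
      (fun x hx => (hder x (interior_subset hx)).mono interior_subset) fun x hx => ?_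
    exact le_trans (mul_nonneg (by linarith) (sq_nonneg _)) (hge x (interior_subset hx))
  have hzero : ∀ x ∈ Set.Icc l r, f x * f₁ x - ψ x * f x ^ 2 = 0 := by
    intro x hx
    have hlr := hx.1.trans hx.2
    refine le_antisymm ?_ ?_
    · simpa [hr] using hmono hx ⟨hlr, le_rfl⟩ hx.2
    · simpa [hl] using hmono ⟨le_rfl, hlr⟩ hx hx.1
  intro x hx
  rcases hx.1.eq_or_lt with rfl | h1
  · exact hl
  rcases hx.2.eq_or_lt with rfl | h2
  · exact hr
  have hn : Set.Icc l r ∈ nhds x := Icc_mem_nhds h1 h2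
  have hd0 : HasDerivAt (fun x => f x * f₁ x - ψ x * f x ^ 2) 0 x :=
    (hasDerivAt_const x (0 : ℝ)).congr_of_eventuallyEq
      (Filter.eventuallyEq_of_mem hn fun y hy => hzero y hy)
  have h3 := hge x hx
  rw [((hder x hx).hasDerivAt hn).unique hd0] at h3
  have h4 : f x ^ 2 ≤ 0 := by
    by_contra hcon
    push Not at hcon
    nlinarith [mul_pos (sub_pos.2 hν) hcon]
  exact pow_eq_zero_iff (two_ne_zero) |>.1 (le_antisymm h4 (sq_nonneg _))

/-- The complex-valued form of `eqOn_zero_of_riccati`, by taking real and imaginary parts. -/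
theorem eqOn_zero_of_riccati_complex {a ν κ l r : ℝ} (hν : ν < κ) {ψ ψ' : ℝ → ℝ}
    {u u₁ : ℝ → ℂ} (hu : ∀ x ∈ Set.Icc l r, HasDerivWithinAt u (u₁ x) (Set.Icc l r) x ∧
      HasDerivWithinAt u₁ ((((a : ℂ) * x) ^ 2 - ν) * u x) (Set.Icc l r) x)
    (hψ : ∀ x, HasDerivAt ψ (ψ' x) x)
    (hric : ∀ x ∈ Set.Icc l r, ψ' x + ψ x ^ 2 ≤ (a * x) ^ 2 - κ)
    (hl : u l = 0) (hr : u r = 0) : ∀ x ∈ Set.Icc l r, u x = 0 := by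
  have hq : ∀ x : ℝ, (((a : ℂ) * x) ^ 2 - ν) = (((a * x) ^ 2 - ν : ℝ) : ℂ) := fun x => by
    push_cast; ring
  have hre := eqOn_zero_of_riccati (f := fun x => (u x).re) (f₁ := fun x => (u₁ x).re) hν
    (fun x hx => Complex.reCLM.hasFDerivAt.comp_hasDerivWithinAt x (hu x hx).1)
    (fun x hx => (Complex.reCLM.hasFDerivAt.comp_hasDerivWithinAt x (hu x hx).2).congr_deriv
      (by rw [hq]; simp only [Complex.reCLM_apply, Complex.re_ofReal_mul])) hψ hric
    (by simp [hl]) (by simp [hr])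
  have him := eqOn_zero_of_riccati (f := fun x => (u x).im) (f₁ := fun x => (u₁ x).im) hν
    (fun x hx => Complex.imCLM.hasFDerivAt.comp_hasDerivWithinAt x (hu x hx).1)
    (fun x hx => (Complex.imCLM.hasFDerivAt.comp_hasDerivWithinAt x (hu x hx).2).congr_deriv
      (by rw [hq]; simp only [Complex.imCLM_apply, Complex.im_ofReal_mul])) hψ hric
    (by simp [hl]) (by simp [hr])
  exact fun x hx => Complex.ext (hre x hx) (him x hx)

theorem hasDerivWithinAt_comp_neg {u : ℝ → ℂ} {u' : ℂ} {x l r : ℝ}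
    (h : HasDerivWithinAt u u' (Set.Icc (-r) (-l)) (-x)) :
    HasDerivWithinAt (fun y => u (-y)) (-u') (Set.Icc l r) x := by
  have := HasDerivWithinAt.scomp x h (hasDerivAt_neg x).hasDerivWithinAt
    (fun y (hy : y ∈ Set.Icc l r) => ⟨neg_le_neg hy.2, neg_le_neg hy.1⟩)
  simpa [Function.comp_def] using this

/-- The eigenvalues are at least the ground state energy `a` of the oscillator on the line, whose
logarithmic derivative is `ψ = -a x`. -/
theorem le_of_isDirichletEigenfunction {a ν : ℝ} {u : ℝ → ℂ}
    (hu : IsDirichletEigenfunction a ν u) : a ≤ ν := by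
  obtain ⟨x, hx, hne⟩ := hu.1
  obtain ⟨hl, hr, u₁, hd⟩ := hu.exists_hasDerivWithinAt
  by_contra! hν
  refine hne (eqOn_zero_of_riccati_complex (ψ := fun x => -a * x) (ψ' := fun _ => -a) hν hd
    (fun x => by simpa using (hasDerivAt_id x).const_mul (-a)) (fun x _ => ?_) hl hr x hx)
  ring_nf
  exact le_rfl

/-- An eigenfunction that vanishes at `0` has eigenvalue at least `a + 1/4`. -/
theorem add_quarter_le_of_isDirichletEigenfunction {a ν : ℝ} (ha : 0 ≤ a) {u : ℝ → ℂ}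
    (hu : IsDirichletEigenfunction a ν u) (h0 : u 0 = 0) : a + 1 / 4 ≤ ν := by
  obtain ⟨x, hx, hne⟩ := hu.1
  obtain ⟨hl, hr, u₁, hd⟩ := hu.exists_hasDerivWithinAt
  by_contra! hν
  -- `-a x` is the logarithmic derivative of the ground state on the line; vanishing at `0` leaves
  -- room for the extra term `(1 - x) / 2`, which raises the bound by `1 / 4`.
  have hψ : ∀ x : ℝ, HasDerivAt (fun x : ℝ => -a * x + (1 - x) / 2) (-a - 1 / 2) x := fun x =>
    (((hasDerivAt_id x).const_mul (-a)).add (((hasDerivAt_id x).const_sub 1).div_const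
      2)).congr_deriv (by simp; ring)
  have hric : ∀ x ∈ Set.Icc (0 : ℝ) 1, (-a - 1 / 2) + (-a * x + (1 - x) / 2) ^ 2 ≤
      (a * x) ^ 2 - (a + 1 / 4) := by
    intro x hx
    nlinarith [mul_nonneg ha (mul_nonneg hx.1 (sub_nonneg.2 hx.2)),
      mul_nonneg hx.1 (sub_nonneg.2 hx.2), hx.1, hx.2]
  have hright : ∀ x ∈ Set.Icc (0 : ℝ) 1, u x = 0 :=
    eqOn_zero_of_riccati_complex hν (fun x hx => by
      have hsub : Set.Icc (0 : ℝ) 1 ⊆ Set.Icc (-1) 1 := Set.Icc_subset_Icc_left (by norm_num)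
      exact ⟨(hd x (hsub hx)).1.mono hsub, (hd x (hsub hx)).2.mono hsub⟩) hψ hric h0 hr
  have hleft : ∀ x ∈ Set.Icc (0 : ℝ) 1, u (-x) = 0 :=
    eqOn_zero_of_riccati_complex (u := fun x => u (-x)) (u₁ := fun x => -u₁ (-x)) hν
      (fun x hx => by
        have hsub : Set.Icc (-1 : ℝ) (-0) ⊆ Set.Icc (-1) 1 :=
          Set.Icc_subset_Icc_right (by norm_num)
        have hx' : -x ∈ Set.Icc (-1 : ℝ) (-0) := ⟨neg_le_neg hx.2, neg_le_neg hx.1⟩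
        refine ⟨hasDerivWithinAt_comp_neg ((hd _ (hsub hx')).1.mono hsub),
          (hasDerivWithinAt_comp_neg ((hd _ (hsub hx')).2.mono hsub)).neg.congr_deriv ?_⟩
        push_cast
        ring) hψ hric (by simpa using h0) hl
  rcases le_total 0 x with h | h
  · exact hne (hright x ⟨h, hx.2⟩)
  · exact hne (by simpa using hleft (-x) ⟨by linarith, by linarith [hx.1]⟩)

/-- Eigenvalues below `a + 1/4` are roots of the equation for the even solution: the even part of
an eigenfunction with `u 0 ≠ 0` is a multiple of it. -/
theorem mul_evenCorrector_one_eq_one_of_eigenvalue {a ν : ℝ} (ha : 0 ≤ a) {u : ℝ → ℂ}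
    (hu : IsDirichletEigenfunction a ν u) (hν : ν < a + 1 / 4) :
    ((ν : ℂ) - a) * evenCorrector a ((ν : ℂ) - a) 1 = 1 := by
  have h0 : u 0 ≠ 0 := fun h0 =>
    absurd (add_quarter_le_of_isDirichletEigenfunction ha hu h0) (not_le.2 hν)
  obtain ⟨hl, hr, u₁, hd⟩ := hu.exists_hasDerivWithinAt
  have hsol : IsNormalizedSolution a ν (fun x => (u x + u (-x)) / (2 * u 0)) := by
    refine ⟨fun x => (u₁ x + -u₁ (-x)) / (2 * u 0),
      fun x => ((((a : ℂ) * x) ^ 2 - ν) * ((u x + u (-x)) / (2 * u 0))), ?_, by simp,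
      fun x hx => ?_⟩
    · simp only [neg_zero]
      field_simp
      ring
    · have hx' : -x ∈ Set.Icc (-1 : ℝ) (- -1) := ⟨neg_le_neg hx.2, neg_le_neg hx.1⟩
      have hsub : Set.Icc (-1 : ℝ) (- -1) ⊆ Set.Icc (-1) 1 :=
        Set.Icc_subset_Icc_right (by norm_num)
      have hd' := hd _ (hsub hx')
      refine ⟨((hd x hx).1.add (hasDerivWithinAt_comp_neg (hd'.1.mono hsub))).div_const _,
        (((hd x hx).2.add (hasDerivWithinAt_comp_neg (hd'.2.mono hsub)).neg).div_const
          _).congr_deriv ?_, by ring⟩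
      push_cast
      ring
  have hy := isNormalizedSolution_evenSolution (a : ℂ) ((ν : ℂ) - a)
  rw [add_sub_cancel] at hy
  have h1 := hsol.eqOn hy (x := 1) (by norm_num)
  rw [← evenSolution_one_eq_zero_iff, ← h1]
  simp [hl, hr]

/-! ### Sectors -/

theorem cos_pos_of_mem_Ioo {θ : ℝ} (hθ : θ ∈ Set.Ioo (0 : ℝ) (Real.pi / 2)) : 0 < Real.cos θ :=
  Real.cos_pos_of_mem_Ioo ⟨by linarith [hθ.1, hθ.2], hθ.2⟩

theorem mem_truncSector_iff {θ ρ : ℝ} (hθ : θ ∈ Set.Ioo (0 : ℝ) (Real.pi / 2)) (hρ : 0 ≤ ρ)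
    {z : ℂ} : z ∈ truncSector θ ρ ↔ ρ < ‖z‖ ∧ Real.cos θ * ‖z‖ < z.re := by
  refine and_congr_right fun hz => ?_
  have hz0 : 0 < ‖z‖ := hρ.trans_lt hz
  rw [← Complex.norm_mul_cos_arg z, mul_comm, mul_lt_mul_iff_right₀ hz0, ← Real.cos_abs z.arg]
  exact (Real.strictAntiOn_cos.lt_iff_gt ⟨hθ.1.le, by linarith [hθ.2, Real.pi_pos]⟩
    ⟨abs_nonneg _, Complex.abs_arg_le_pi z⟩).symm

theorem isOpen_truncSector {θ ρ : ℝ} (hθ : θ ∈ Set.Ioo (0 : ℝ) (Real.pi / 2)) (hρ : 0 ≤ ρ) :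
    IsOpen (truncSector θ ρ) := by
  have h : truncSector θ ρ = {z | ρ < ‖z‖} ∩ {z | Real.cos θ * ‖z‖ < z.re} :=
    Set.ext fun z => mem_truncSector_iff hθ hρ
  rw [h]
  exact (isOpen_lt continuous_const continuous_norm).inter
    (isOpen_lt (continuous_const.mul continuous_norm) Complex.continuous_re)

theorem isPreconnected_truncSector {θ ρ : ℝ} (hθ : θ ∈ Set.Ioo (0 : ℝ) (Real.pi / 2))
    (hρ : 0 ≤ ρ) : IsPreconnected (truncSector θ ρ) := by
  have h : truncSector θ ρ = (fun p : ℝ × ℝ =>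
      (p.1 : ℂ) * (Complex.cos p.2 + Complex.sin p.2 * Complex.I)) ''
        (Set.Ioi ρ ×ˢ Set.Ioo (-θ) θ) := by
    ext z
    constructor
    · rintro ⟨h1, h2⟩
      exact ⟨(‖z‖, z.arg), ⟨h1, abs_lt.1 h2⟩, Complex.norm_mul_cos_add_sin_mul_I z⟩
    · rintro ⟨⟨p, t⟩, ⟨hp, ht⟩, rfl⟩
      have hp0 : 0 < p := hρ.trans_lt hp
      dsimp only at ht ⊢
      refine ⟨?_, ?_⟩
      · rw [norm_mul, Complex.norm_cos_add_sin_mul_I, mul_one, Complex.norm_real,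
          Real.norm_of_nonneg hp0.le]
        exact hp
      · rw [Complex.arg_mul_cos_add_sin_mul_I hp0
          ⟨by linarith [ht.1, hθ.2, Real.pi_pos], by linarith [ht.2, hθ.2, Real.pi_pos]⟩]
        exact abs_lt.2 ht
  rw [h]
  exact (isPreconnected_Ioi.prod isPreconnected_Ioo).image _ (by fun_prop)

theorem isOpen_symbolDomain (r : RadiusFn) : IsOpen (symbolDomain r) :=
  isOpen_iUnion fun θ => isOpen_truncSector θ.2 (r θ).2

theorem ofReal_mem_truncSector {θ ρ a : ℝ} (hθ : θ ∈ Set.Ioo (0 : ℝ) (Real.pi / 2)) (hρ : 0 ≤ ρ)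
    (ha : ρ < a) : (a : ℂ) ∈ truncSector θ ρ := by
  have ha0 : 0 < a := hρ.trans_lt ha
  refine ⟨?_, ?_⟩
  · rwa [Complex.norm_real, Real.norm_of_nonneg ha0.le]
  · rw [Complex.arg_ofReal_of_nonneg ha0.le, abs_zero]
    exact hθ.1

/-- Any two of the truncated sectors share a point of the real axis. -/
theorem isPreconnected_symbolDomain (r : RadiusFn) : IsPreconnected (symbolDomain r) := by
  refine isPreconnected_of_forall_pair fun x hx y hy => ?_
  obtain ⟨θ, hθ⟩ := Set.mem_iUnion.1 hx
  obtain ⟨θ', hθ'⟩ := Set.mem_iUnion.1 hy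
  refine ⟨truncSector θ (r θ) ∪ truncSector θ' (r θ'),
    Set.union_subset (truncSector_subset_symbolDomain r θ) (truncSector_subset_symbolDomain r θ'),
    Or.inl hθ, Or.inr hθ', ?_⟩
  refine IsPreconnected.union (((max (r θ : ℝ) (r θ') + 1 : ℝ)) : ℂ)
    (ofReal_mem_truncSector θ.2 (r θ).2 ?_) (ofReal_mem_truncSector θ'.2 (r θ').2 ?_)
    (isPreconnected_truncSector θ.2 (r θ).2) (isPreconnected_truncSector θ'.2 (r θ').2)
  · linarith [le_max_left (r θ : ℝ) (r θ')]
  · linarith [le_max_right (r θ : ℝ) (r θ')]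

/-- The radius function `10⁴ / cos⁴ θ`. Since `Re z > |z| cos θ` in the sector, this is the size of
`|z|` beyond which `100 |z|^{3/2} < (Re z)²`, so that the domain lies in `asymptoticRegion`. -/
noncomputable def baseRadius : RadiusFn where
  toFun θ := ⟨10 ^ 4 / Real.cos θ ^ 4, by positivity⟩
  monotone' θ θ' h := by
    have h1 := cos_pos_of_mem_Ioo θ'.2
    have h2 : Real.cos θ' ≤ Real.cos θ := Real.cos_le_cos_of_nonneg_of_le_pi θ.2.1.le
      (by linarith [θ'.2.2, Real.pi_pos]) h
    refine NNReal.coe_le_coe.1 ?_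
    change (10 : ℝ) ^ 4 / Real.cos θ ^ 4 ≤ 10 ^ 4 / Real.cos θ' ^ 4
    gcongr

theorem symbolDomain_baseRadius_subset : symbolDomain baseRadius ⊆ asymptoticRegion := by
  intro z hz
  obtain ⟨θ, hθ⟩ := Set.mem_iUnion.1 hz
  obtain ⟨h1, h2⟩ := (mem_truncSector_iff θ.2 (baseRadius θ).2).1 hθ
  have hc := cos_pos_of_mem_Ioo θ.2
  have hc1 : Real.cos θ ≤ 1 := Real.cos_le_one θ
  change (10 : ℝ) ^ 4 / Real.cos θ ^ 4 < ‖z‖ at h1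
  rw [div_lt_iff₀ (by positivity)] at h1
  set c := Real.cos θ
  have hA0 : 0 < ‖z‖ := by
    by_contra! h
    nlinarith [pow_pos hc 4]
  have hs0 : 0 < √‖z‖ := Real.sqrt_pos.2 hA0
  have hs : √‖z‖ * √‖z‖ = ‖z‖ := Real.mul_self_sqrt hA0.le
  refine ⟨?_, ?_⟩
  · have h3 : c ^ 4 ≤ c := pow_le_of_le_one hc.le hc1 (by norm_num)
    nlinarith [mul_le_mul_of_nonneg_left h3 hA0.le]
  · have h4 : 100 < √‖z‖ * c ^ 2 := by
      refine lt_of_pow_lt_pow_left₀ 2 (by positivity) ?_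
      calc (100 : ℝ) ^ 2 < ‖z‖ * c ^ 4 := by linarith
        _ = (√‖z‖ * c ^ 2) ^ 2 := by linear_combination (-c ^ 4) * hs
    calc 100 * (‖z‖ * √‖z‖) < √‖z‖ * c ^ 2 * (‖z‖ * √‖z‖) := by gcongr
      _ = (c * ‖z‖) ^ 2 := by
        linear_combination (c ^ 2 * ‖z‖) * hs
      _ < z.re ^ 2 := by gcongr

/-! ### Existence of the eigenvalue symbol -/

theorem im_eq_zero_of_mul_evenCorrector_one_eq_one {a : ℝ} (ha : (a : ℂ) ∈ asymptoticRegion)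
    {μ : ℂ} (hμ : ‖μ‖ ≤ 1 / 4) (h : μ * evenCorrector a μ 1 = 1) : μ.im = 0 := by
  refine Complex.conj_eq_iff_im.1 (eq_of_mul_evenCorrector_one_eq_one ha
    (by rwa [Complex.norm_conj]) hμ ?_ h)
  have h1 := corrector_conj (a : ℂ) μ (((1 : ℝ) : ℂ) ^ 2)
  rw [map_pow, Complex.conj_ofReal, Complex.conj_ofReal] at h1
  unfold evenCorrector at h ⊢
  rw [h1, ← map_mul, h, map_one]

theorem isFirstEigenvalue_add {a m : ℝ} (ha : (a : ℂ) ∈ asymptoticRegion) (hm : |m| ≤ 1 / 4)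
    (h : (m : ℂ) * evenCorrector a m 1 = 1) : IsFirstEigenvalue a (a + m) := by
  have ha0 : 0 ≤ a := by have := ha.1; rw [Complex.ofReal_re] at this; linarith
  have h1 : evenSolution a m 1 = 0 := evenSolution_one_eq_zero_iff.2 h
  refine ⟨⟨evenSolution a m, ?_⟩, ?_⟩
  · rw [Complex.ofReal_add]
    exact (isNormalizedSolution_evenSolution a m).isDirichletEigenfunction
      (by rw [evenSolution_neg, h1]) h1
  · rintro ν ⟨u, hu⟩
    by_contra! hlt
    have hν := le_of_isDirichletEigenfunction hu
    have hm' := (abs_le.1 hm).2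
    have h2 := mul_evenCorrector_one_eq_one_of_eigenvalue ha0 hu (by linarith)
    have h3 : (ν : ℂ) - a = m := by
      refine eq_of_mul_evenCorrector_one_eq_one ha ?_ (by simpa using hm) h2 h
      rw [← Complex.ofReal_sub, Complex.norm_real, Real.norm_of_nonneg (by linarith)]
      linarith
    have h4 : ν - a = m := by exact_mod_cast h3
    linarith

theorem exists_isEigenpairExtension :
    ∃ (r₀ : RadiusFn) (γ : SymbolSpace r₀) (v : symbolDomain r₀ → ℝ → ℂ),
      IsEigenpairExtension r₀ γ v := by
  obtain ⟨μ, hμd, hμ⟩ := exists_holomorphic_root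
  have hΩ := symbolDomain_baseRadius_subset
  let γ : SymbolSpace baseRadius := ⟨fun z => μ z * Complex.exp z,
    ⟨fun z => μ z * Complex.exp z, (hμd.mono hΩ).mul Complex.differentiable_exp.differentiableOn,
      fun _ => rfl⟩, fun θ η hη => ⟨10 / η ^ 2, by
      rintro _ ⟨z, rfl⟩
      have hz := hΩ (truncSector_subset_symbolDomain baseRadius θ z.2)
      have hA : 1 ≤ ‖(z : ℂ)‖ := by linarith [hz.1, Complex.re_le_norm (z : ℂ)]
      have h1 : ‖μ z * Complex.exp z‖ ≤ 5 * ‖(z : ℂ)‖ ^ 2 := by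
        rw [norm_mul, Complex.norm_exp]
        calc ‖μ z‖ * Real.exp (z : ℂ).re
            ≤ 5 * (‖(z : ℂ)‖ * √‖(z : ℂ)‖) * Real.exp (-(z : ℂ).re) * Real.exp (z : ℂ).re :=
              mul_le_mul_of_nonneg_right (hμ z hz).2.2 (Real.exp_pos _).le
          _ = 5 * (‖(z : ℂ)‖ * √‖(z : ℂ)‖) := by
              rw [mul_assoc, ← Real.exp_add, neg_add_cancel, Real.exp_zero, mul_one]
          _ ≤ 5 * ‖(z : ℂ)‖ ^ 2 := by
              have : √‖(z : ℂ)‖ ≤ ‖(z : ℂ)‖ := Real.sqrt_le_self_iff.2 (Or.inr hA)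
              nlinarith
      have h2 := Real.quadratic_le_exp_of_nonneg (show 0 ≤ η * ‖(z : ℂ)‖ by positivity)
      unfold weightedNorm
      rw [neg_mul, Real.exp_neg, mul_inv_le_iff₀ (Real.exp_pos _)]
      refine h1.trans ?_
      rw [div_mul_eq_mul_div, le_div_iff₀ (by positivity)]
      have : 0 ≤ η * ‖(z : ℂ)‖ := by positivity
      nlinarith⟩⟩
  have hext : ∀ α, extendedEigenvalue γ α = α + μ α := by
    intro α
    change (α : ℂ) + μ α * Complex.exp α * Complex.exp (-α) = α + μ α
    rw [mul_assoc, ← Complex.exp_add, add_neg_cancel, Complex.exp_zero, mul_one]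
  refine ⟨baseRadius, γ, fun α => evenSolution α (μ α), fun a ha => ?_, fun α => ?_⟩
  · obtain ⟨h1, h2, -⟩ := hμ a (hΩ (ofReal_mem_symbolDomain ha))
    have him := im_eq_zero_of_mul_evenCorrector_one_eq_one (hΩ (ofReal_mem_symbolDomain ha)) h1 h2
    have hre : (((μ a).re : ℝ) : ℂ) = μ a := Complex.ext rfl (by simp [him])
    refine ⟨a + (μ a).re, isFirstEigenvalue_add (hΩ (ofReal_mem_symbolDomain ha)) ?_ ?_, ?_⟩
    · exact (Complex.abs_re_le_norm _).trans h1
    · rwa [hre]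
    · rw [hext, Complex.ofReal_add, hre]
  · rw [hext]
    exact isNormalizedSolution_evenSolution _ _

/-! ### Properties of an arbitrary extension -/

theorem SymbolSpace.norm_le {r : RadiusFn} (γ : SymbolSpace r)
    (θ : Set.Ioo (0 : ℝ) (Real.pi / 2)) {η : ℝ} (hη : 0 < η) : ∃ C, 0 ≤ C ∧
      ∀ α : symbolDomain r, (α : ℂ) ∈ truncSector θ (r θ) →
        ‖γ α‖ ≤ C * Real.exp (η * ‖(α : ℂ)‖) := by
  obtain ⟨C, hC⟩ := γ.2.2 θ η hη
  refine ⟨max C 0, le_max_right _ _, fun α hα => ?_⟩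
  have h : ‖γ α‖ * Real.exp (-η * ‖(α : ℂ)‖) ≤ C := hC ⟨⟨α, hα⟩, rfl⟩
  rw [neg_mul, Real.exp_neg, mul_inv_le_iff₀ (Real.exp_pos _)] at h
  exact h.trans (mul_le_mul_of_nonneg_right (le_max_left _ _) (Real.exp_pos _).le)

section Extension

variable {r : RadiusFn} {γ : SymbolSpace r} {v : symbolDomain r → ℝ → ℂ}

theorem IsEigenpairExtension.eq_evenSolution (h : IsEigenpairExtension r γ v) (α : symbolDomain r)
    {x : ℝ} (hx : x ∈ Set.Icc (-1 : ℝ) 1) :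
    v α x = evenSolution α (γ α * Complex.exp (-α)) x :=
  (h.solution α).eqOn (isNormalizedSolution_evenSolution _ _) hx

theorem differentiableOn_evenCorrector {f : ℂ → ℂ} {U : Set ℂ} (hU : IsOpen U)
    (hf : DifferentiableOn ℂ f U) (x : ℝ) :
    DifferentiableOn ℂ (fun z => 1 - f z * evenCorrector z (f z) x) U :=
  (hf.mul (differentiableOn_corrector hU differentiableOn_id hf _)).const_sub 1

/-- The eigenvalue equation holds on the whole domain, by analytic continuation from the large
reals. There the first eigenvalue is close to `α`, so that its eigenfunction is even. -/
theorem IsEigenpairExtension.root (h : IsEigenpairExtension r γ v) (α : symbolDomain r) :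
    γ α * Complex.exp (-α) * evenCorrector α (γ α * Complex.exp (-α)) 1 = 1 := by
  obtain ⟨F, hF, hγ⟩ := γ.2.1
  have hγ' : ∀ z : symbolDomain r, γ z = F z := hγ
  have hd : DifferentiableOn ℂ (fun z => F z * Complex.exp (-z)) (symbolDomain r) :=
    hF.mul (by fun_prop)
  have han := (differentiableOn_evenCorrector (isOpen_symbolDomain r) hd 1).analyticOnNhd
    (isOpen_symbolDomain r)
  let θ : Set.Ioo (0 : ℝ) (Real.pi / 2) :=
    ⟨Real.pi / 4, by constructor <;> linarith [Real.pi_pos]⟩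
  obtain ⟨C, hC0, hC⟩ := γ.norm_le θ (η := 1 / 2) (by norm_num)
  have hlim : Filter.Tendsto (fun a : ℝ => C * Real.exp (-(a / 2))) Filter.atTop (nhds 0) := by
    have h1 : Filter.Tendsto (fun a : ℝ => a / 2) Filter.atTop Filter.atTop :=
      Filter.tendsto_id.atTop_div_const (by norm_num)
    simpa using (Real.tendsto_exp_neg_atTop_nhds_zero.comp h1).const_mul C
  have hev : ∀ᶠ a : ℝ in Filter.atTop, (a : ℂ) ∈ symbolDomain r ∧
      1 - F a * Complex.exp (-a) * evenCorrector a (F a * Complex.exp (-a)) 1 = 0 := by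
    filter_upwards [Filter.eventually_gt_atTop (r.atZero : ℝ), Filter.eventually_gt_atTop (r θ : ℝ),
      hlim.eventually (gt_mem_nhds (show (0 : ℝ) < 1 / 4 by norm_num))] with a ha1 ha2 ha3
    have ha0 : 0 < a := (r θ).2.trans_lt ha2
    have hmem := ofReal_mem_symbolDomain ha1
    refine ⟨hmem, ?_⟩
    obtain ⟨ν, ⟨⟨u, hu⟩, -⟩, hν⟩ := h.eigenvalue a ha1
    have hν' : F a * Complex.exp (-a) = (ν : ℂ) - a := by
      rw [hν, extendedEigenvalue, hγ']
      ring
    have hsmall : ‖F a * Complex.exp (-a)‖ < 1 / 4 := by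
      refine lt_of_le_of_lt ?_ ha3
      have h2 := hC ⟨a, hmem⟩ (ofReal_mem_truncSector θ.2 (r θ).2 ha2)
      rw [hγ'] at h2
      simp only [Complex.norm_real, Real.norm_of_nonneg ha0.le] at h2
      rw [norm_mul, Complex.norm_exp, Complex.neg_re, Complex.ofReal_re]
      calc ‖F a‖ * Real.exp (-a) ≤ C * Real.exp (1 / 2 * a) * Real.exp (-a) :=
            mul_le_mul_of_nonneg_right h2 (Real.exp_pos _).le
        _ = C * Real.exp (-(a / 2)) := by
            rw [mul_assoc, ← Real.exp_add]; congr 2; ring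
    rw [hν', ← Complex.ofReal_sub, Complex.norm_real, Real.norm_eq_abs] at hsmall
    rw [hν', sub_eq_zero]
    exact (mul_evenCorrector_one_eq_one_of_eigenvalue ha0.le hu
      (by linarith [(abs_lt.1 hsmall).2])).symm
  obtain ⟨a₀, ha₀⟩ := Filter.eventually_atTop.1 hev
  have hfreq : ∃ᶠ z in nhdsWithin ((a₀ + 1 : ℝ) : ℂ) {((a₀ + 1 : ℝ) : ℂ)}ᶜ,
      1 - F z * Complex.exp (-z) * evenCorrector z (F z * Complex.exp (-z)) 1 = 0 := by
    have ht : Filter.Tendsto (fun a : ℝ => (a : ℂ)) (nhdsWithin (a₀ + 1) {a₀ + 1}ᶜ)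
        (nhdsWithin ((a₀ + 1 : ℝ) : ℂ) {((a₀ + 1 : ℝ) : ℂ)}ᶜ) :=
      Complex.continuous_ofReal.continuousWithinAt.tendsto_nhdsWithin fun a ha => by
        simpa [← Complex.ofReal_one, ← Complex.ofReal_add] using ha
    refine ht.frequently (Filter.Eventually.frequently ?_)
    filter_upwards [mem_nhdsWithin_of_mem_nhds (Ici_mem_nhds (lt_add_one a₀))] with a ha
    exact (ha₀ a ha).2
  have hzero := han.eqOn_zero_of_preconnected_of_frequently_eq_zero
    (isPreconnected_symbolDomain r) (ha₀ (a₀ + 1) (by linarith)).1 hfreq α.2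
  rw [hγ']
  exact (sub_eq_zero.1 hzero).symm

theorem IsEigenpairExtension.isDirichletEigenfunction (h : IsEigenpairExtension r γ v)
    (α : symbolDomain r) : IsDirichletEigenfunction α (extendedEigenvalue γ α) (v α) := by
  have h1 : evenSolution α (γ α * Complex.exp (-α)) 1 = 0 :=
    evenSolution_one_eq_zero_iff.2 (h.root α)
  refine (h.solution α).isDirichletEigenfunction ?_ ?_
  · rw [h.eq_evenSolution α (by norm_num), evenSolution_neg, h1]
  · rw [h.eq_evenSolution α (by norm_num), h1]

/-- Multiplying `v_α` by a Gaussian `e^{βαx²/2}` preserves holomorphy in `α`. -/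
theorem IsEigenpairExtension.isHolomorphic_exp_mul (h : IsEigenpairExtension r γ v) (β : ℂ)
    {x : ℝ} (hx : x ∈ Set.Icc (-1 : ℝ) 1) :
    IsHolomorphic (fun α : symbolDomain r =>
      Complex.exp ((α : ℂ) * β * (x : ℂ) ^ 2 / 2) * v α x) := by
  obtain ⟨F, hF, hγ⟩ := γ.2.1
  have hγ' : ∀ z : symbolDomain r, γ z = F z := hγ
  have hd : DifferentiableOn ℂ (fun z => F z * Complex.exp (-z)) (symbolDomain r) :=
    hF.mul (by fun_prop)
  refine ⟨fun z => Complex.exp (z * β * (x : ℂ) ^ 2 / 2) *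
    evenSolution z (F z * Complex.exp (-z)) x, ?_, fun α => ?_⟩
  · unfold evenSolution
    exact DifferentiableOn.mul (by fun_prop) (DifferentiableOn.mul (by fun_prop)
      (differentiableOn_evenCorrector (isOpen_symbolDomain r) hd x))
  · dsimp only
    rw [h.eq_evenSolution α hx, hγ']

/-- On a sector, `1 - μ k(x²)` with `μ = γ(α) e^{-α}` grows subexponentially, uniformly in `x`:
the gain `e^{-Re α}` in `μ` compensates the growth `e^{x² Re α}` of the corrector. -/
theorem SymbolSpace.exists_norm_one_sub_le (γ : SymbolSpace r)
    (θ : Set.Ioo (0 : ℝ) (Real.pi / 2)) {η : ℝ} (hη : 0 < η) :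
    ∃ C, 0 ≤ C ∧ ∀ α : symbolDomain r, (α : ℂ) ∈ truncSector θ (r θ) → ∀ x ∈ Set.Icc (-1 : ℝ) 1,
      ‖1 - γ α * Complex.exp (-α) * evenCorrector α (γ α * Complex.exp (-α)) x‖ ≤
        C * Real.exp (η * ‖(α : ℂ)‖) := by
  have hc := cos_pos_of_mem_Ioo θ.2
  set c := Real.cos θ
  obtain ⟨B, hB0, hB⟩ := γ.norm_le θ (lt_min hη hc)
  set K := 2 * (B / c) + B + 1
  refine ⟨1 + (B + Real.exp 1 + B * Real.exp K), by positivity, fun α hα x hx => ?_⟩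
  obtain ⟨hA, hcb⟩ := (mem_truncSector_iff θ.2 (r θ).2).1 hα
  have hA0 : 0 ≤ ‖(α : ℂ)‖ := norm_nonneg _
  have hb0 : 0 < (α : ℂ).re := lt_of_le_of_lt (by positivity) hcb
  have hx2 : x ^ 2 ≤ 1 := by nlinarith [hx.1, hx.2]
  have hγ := hB α hα
  set μ := γ α * Complex.exp (-α) with hμdef
  have hμ : ‖μ‖ = ‖γ α‖ * Real.exp (-(α : ℂ).re) := by
    rw [hμdef, norm_mul, Complex.norm_exp, Complex.neg_re]
  have hγη : ‖γ α‖ ≤ B * Real.exp (η * ‖(α : ℂ)‖) := hγ.trans (by gcongr; exact min_le_left _ _)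
  have hμB : ‖μ‖ ≤ B := by
    rw [hμ, Real.exp_neg, mul_inv_le_iff₀ (Real.exp_pos _)]
    refine hγ.trans (mul_le_mul_of_nonneg_left (Real.exp_le_exp.2 ?_) hB0)
    exact (mul_le_mul_of_nonneg_right (min_le_right _ _) hA0).trans hcb.le
  have hE : 1 ≤ Real.exp (η * ‖(α : ℂ)‖) := Real.one_le_exp (by positivity)
  have hBK : 0 ≤ B * Real.exp K := by positivity
  have he1 := Real.exp_pos 1
  have hmain : ‖μ‖ * ‖evenCorrector α μ x‖ ≤
      (B + Real.exp 1 + B * Real.exp K) * Real.exp (η * ‖(α : ℂ)‖) := by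
    rcases le_or_gt ‖μ‖ (α : ℂ).re with hle | hlt
    · have hg : ‖evenCorrector α μ x‖ ≤ Real.exp (α : ℂ).re / (α : ℂ).re := by
        have h1 := norm_evenCorrector_le hb0 hle (x := |x|) ⟨abs_nonneg x, abs_le.2 hx⟩
        have h2 : evenCorrector α μ |x| = evenCorrector α μ x := by
          rcases abs_choice x with h | h <;> rw [h]
          exact evenCorrector_neg _ _ _
        rw [h2, sq_abs] at h1
        refine h1.trans (div_le_div_of_nonneg_right (Real.exp_le_exp.2 ?_) hb0.le)
        exact mul_le_of_le_one_right hb0.le hx2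
      rcases le_or_gt 1 (α : ℂ).re with hb1 | hb1
      · have h3 : ‖μ‖ * ‖evenCorrector α μ x‖ ≤ ‖γ α‖ := by
          calc ‖μ‖ * ‖evenCorrector α μ x‖
              ≤ ‖γ α‖ * Real.exp (-(α : ℂ).re) * Real.exp (α : ℂ).re := by
                rw [← hμ]
                exact mul_le_mul_of_nonneg_left
                  (hg.trans (div_le_self (Real.exp_pos _).le hb1)) (norm_nonneg _)
            _ = ‖γ α‖ := by
                rw [mul_assoc, ← Real.exp_add, neg_add_cancel, Real.exp_zero, mul_one]
        nlinarith
      · have h3 : ‖μ‖ * ‖evenCorrector α μ x‖ ≤ Real.exp 1 := by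
          calc ‖μ‖ * ‖evenCorrector α μ x‖
              ≤ (α : ℂ).re * (Real.exp (α : ℂ).re / (α : ℂ).re) := by gcongr
            _ = Real.exp (α : ℂ).re := mul_div_cancel₀ _ hb0.ne'
            _ ≤ Real.exp 1 := Real.exp_le_exp.2 hb1.le
        nlinarith
    · -- Here `cos θ |α| < Re α < |μ| ≤ B`, so that `α` and `μ` are bounded.
      have hAB : ‖(α : ℂ)‖ ≤ B / c := by rw [le_div_iff₀ hc]; linarith
      have hg : ‖evenCorrector α μ x‖ ≤ Real.exp K := by
        refine norm_corrector_le (by unfold correctorType; linarith) ?_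
        rw [norm_pow, Complex.norm_real, Real.norm_eq_abs, sq_abs]
        exact hx2
      have h3 : ‖μ‖ * ‖evenCorrector α μ x‖ ≤ B * Real.exp K := by gcongr
      nlinarith
  refine (norm_sub_le _ _).trans ?_
  rw [norm_one, norm_mul]
  linarith

/-- The family `e^{α(1-ε)x²/2} v_α(x)` is dominated on each sector, uniformly in `x`. -/
theorem IsEigenpairExtension.exists_weightedNorm_le (h : IsEigenpairExtension r γ v) {ε : ℝ}
    (hε : 0 < ε) (θ : Set.Ioo (0 : ℝ) (Real.pi / 2)) {η : ℝ} (hη : 0 < η) :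
    ∃ C, 0 ≤ C ∧ ∀ x ∈ Set.Icc (-1 : ℝ) 1, ∀ z, weightedNorm r θ η (fun α : symbolDomain r =>
      Complex.exp ((α : ℂ) * (1 - (ε : ℂ)) * (x : ℂ) ^ 2 / 2) * v α x) z ≤ C := by
  obtain ⟨C, hC0, hC⟩ := γ.exists_norm_one_sub_le θ hη
  refine ⟨C, hC0, fun x hx z => ?_⟩
  set α := Set.inclusion (truncSector_subset_symbolDomain r θ) z
  have hb0 : 0 < (α : ℂ).re := lt_of_le_of_lt
    (mul_nonneg (cos_pos_of_mem_Ioo θ.2).le (norm_nonneg _))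
    ((mem_truncSector_iff θ.2 (r θ).2).1 z.2).2
  have h1 := hC α z.2 x hx
  have h2 : Complex.exp ((α : ℂ) * (1 - (ε : ℂ)) * (x : ℂ) ^ 2 / 2) * v α x =
      Complex.exp ((-(ε / 2 : ℝ) * α : ℂ) * (x : ℂ) ^ 2) *
        (1 - γ α * Complex.exp (-α) * evenCorrector α (γ α * Complex.exp (-α)) x) := by
    rw [h.eq_evenSolution α hx, evenSolution, ← mul_assoc, ← Complex.exp_add]
    congr 2
    push_cast
    ring
  have h3 : ‖Complex.exp ((-(ε / 2 : ℝ) * α : ℂ) * (x : ℂ) ^ 2)‖ ≤ 1 := by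
    rw [norm_exp_mul_ofReal_sq, Real.exp_le_one_iff, ← Complex.ofReal_neg, Complex.re_ofReal_mul]
    have : 0 ≤ ε / 2 * (α : ℂ).re * x ^ 2 := by positivity
    linarith
  unfold weightedNorm
  rw [neg_mul, Real.exp_neg, mul_inv_le_iff₀ (Real.exp_pos _)]
  refine le_trans ?_ h1
  change ‖Complex.exp ((α : ℂ) * (1 - (ε : ℂ)) * (x : ℂ) ^ 2 / 2) * v α x‖ ≤ _
  rw [h2, norm_mul]
  exact mul_le_of_le_one_left (norm_nonneg _) h3

end Extension

theorem withSeminorms_symbolSeminormFamily (r : RadiusFn) :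
    WithSeminorms (symbolSeminormFamily r) := ⟨rfl⟩

theorem mainTheorem6 :
    (∃ (r₀ : RadiusFn) (γ : SymbolSpace r₀) (v : symbolDomain r₀ → ℝ → ℂ),
      IsEigenpairExtension r₀ γ v) ∧
    ∀ (r₀ : RadiusFn) (γ : SymbolSpace r₀) (v : symbolDomain r₀ → ℝ → ℂ),
      IsEigenpairExtension r₀ γ v →
      (∀ x ∈ Set.Icc (-1 : ℝ) 1, IsHolomorphic (fun α : symbolDomain r₀ => v α x)) ∧
      (∀ α : symbolDomain r₀, IsDirichletEigenfunction α (extendedEigenvalue γ α) (v α)) ∧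
      ∀ ε : ℝ, 0 < ε → ε ≤ 1 →
        ∃ (r : RadiusFn) (hr : r₀ ≤ r) (w : Set.Icc (-1 : ℝ) 1 → SymbolSpace r),
          (∀ (x : Set.Icc (-1 : ℝ) 1) (α : symbolDomain r),
            w x α = Complex.exp ((α : ℂ) * (1 - (ε : ℂ)) * ((x : ℝ) : ℂ) ^ 2 / 2) *
              v (Set.inclusion (symbolDomain_anti hr) α) x) ∧
          Bornology.IsVonNBounded ℂ (Set.range w) := by
  refine ⟨exists_isEigenpairExtension, fun r γ v h => ⟨fun x hx => ?_,
    h.isDirichletEigenfunction, fun ε hε _ => ?_⟩⟩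
  · simpa using h.isHolomorphic_exp_mul 0 hx
  -- The bounds hold without enlarging the radius function.
  · refine ⟨r, le_rfl, fun x => ⟨fun α =>
      Complex.exp ((α : ℂ) * (1 - (ε : ℂ)) * ((x : ℝ) : ℂ) ^ 2 / 2) * v α x,
      h.isHolomorphic_exp_mul _ x.2, fun θ η hη => ?_⟩, fun x α => rfl, ?_⟩
    · obtain ⟨C, -, hC⟩ := h.exists_weightedNorm_le hε θ hη
      exact ⟨C, by rintro _ ⟨z, rfl⟩; exact hC x x.2 z⟩
    · rw [(withSeminorms_symbolSeminormFamily r).isVonNBounded_iff_seminorm_bounded]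
      rintro ⟨θ, η⟩
      obtain ⟨C, hC0, hC⟩ := h.exists_weightedNorm_le hε θ η.2
      refine ⟨C + 1, by linarith, ?_⟩
      rintro _ ⟨x, rfl⟩
      exact lt_of_le_of_lt (Real.iSup_le (fun z => hC x x.2 z) hC0) (lt_add_one C)
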